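/- For positive integers $s_1,\dots,s_d\ge 2$ and signs $\varepsilon_1,\dots,\varepsilon_d\in\{1,-1\}$ let $$\zeta(s_1,\dots,s_d;\varepsilon_1,\dots,\varepsilon_d)=\sum_{n_1>\cdots>n_d\ge 1}\frac{\varepsilon_1^{n_1}\cdots\varepsilon_d^{n_d}}{n_1^{s_1}\cdots n_d^{s_d}}$$ (an absolutely convergent series), and for $0\le \alpha\le d\le n$ let $$A_\alpha(2n,d)=\sum_{\substack{j_1+\cdots+j_d=n,\ j_1,\dots,j_d>0\\ \sharp\{\ell:\ \varepsilon_\ell=-1\}=\alpha}}\zeta(2j_1,\dots,2j_d;\varepsilon_1,\dots,\varepsilon_d),$$ the sum being over all such $(j_1,\dots,j_d)$ and all such sign vectors. In particular $A_d(2n,d)$ is the sum of all totally alternating Euler sums $\zeta(\overline{2j_1},\dots,\overline{2j_d})$ of weight $2n$ and depth $d$. Then for all positive integers $d\le n$ every series occurring in $A_d(2n,d)$ converges absolutely, and \begin{align*} A_d(2n,d)=&\sum_{j=0}^{\lfloor(d-1)/2\rfloor}\frac{(-1)^j4^{j-n-d+1}}{(2j+1)!}\binom{2d-2j-1}{d}\zeta(2n-2j)\pi^{2j}\\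 +&\sum_{c=1}^d\sum_{j=0}^{\lfloor(c-1)/2\rfloor}\sum_{k=0}^{\lfloor(d-c)/2\rfloor}\frac{(-1)^{c+j+k}(1-4^{j+k-n})}{c\,(2j)!(2k)!\,4^{d-1}}\binom{2c-2j-2}{c-1}\binom{2d-2c-2k}{d-c}z_{n,j,k}\\ +&\sum_{c=1}^d\sum_{j=1}^{\lfloor c/2\rfloor}\sum_{k=0}^{\lfloor(d-c-1)/2\rfloor}\frac{(-1)^{c+j+k}4^{j+k-n-d+1}}{c\,(2j-1)!(2k+1)!}\binom{2c-2j-1}{c-1}\binom{2d-2c-2k-1}{d-c}z_{n,j,k}, \end{align*} where $\zeta$ of one argument is the Riemann zeta function, $z_{n,j,k}=\zeta(2n-2j-2k)\pi^{2j+2k}$, and a sum whose upper limit is less than its lower limit is empty. -/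

import Mathlib

noncomputable section

namespace EulerSums

/-- The set of indices of a depth `d` Euler sum: tuples of positive integers
`n₁ > n₂ > ⋯ > n_d ≥ 1`. -/
abbrev Index (d : ℕ) : Type := {m : Fin d → ℕ+ // StrictAnti m}

/-- The general term `∏ᵢ εᵢ ^ nᵢ / nᵢ ^ sᵢ` of an Euler sum with exponents `s` and signs `ε`. -/
def term {d : ℕ} (s : Fin d → ℕ) (ε : Fin d → ℤˣ) (m : Index d) : ℝ :=
  ∏ i, (((ε i : ℤˣ) : ℤ) : ℝ) ^ (m.1 i : ℕ) / ((m.1 i : ℕ) : ℝ) ^ s i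

/-- The (alternating) Euler sum `ζ(s₁, …, s_d; ε₁, …, ε_d)`, as an unconditional sum.
It is used here only for exponents `sᵢ ≥ 2`, where the series converges absolutely. -/
def eulerSum {d : ℕ} (s : Fin d → ℕ) (ε : Fin d → ℤˣ) : ℝ :=
  ∑' m : Index d, term s ε m

/-- The tuples `(j₁, …, j_d)` of positive integers with `j₁ + ⋯ + j_d = n`. -/
def compositions (n d : ℕ) : Finset (Fin d → ℕ) :=
  {j ∈ Finset.Nat.antidiagonalTuple d n | ∀ i, 0 < j i}

/-- The sign vectors of length `d` with exactly `a` entries equal to `-1`. -/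
def signs (a d : ℕ) : Finset (Fin d → ℤˣ) :=
  {ε : Fin d → ℤˣ | (Finset.univ.filter fun i => ε i = -1).card = a}

/-- The restricted sum `A_a(2n, d)` of all Euler sums of weight `2n` and depth `d` at even
arguments `2j₁, …, 2j_d` having exactly `a` alternating components. -/
def A (a n d : ℕ) : ℝ :=
  ∑ j ∈ compositions n d, ∑ ε ∈ signs a d, eulerSum (fun i => 2 * j i) ε

/-- `z_{n,j,k} = ζ(2n - 2j - 2k) π ^ (2j + 2k)`, with `ζ` the Riemann zeta function. -/
def z (n j k : ℕ) : ℂ :=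
  riemannZeta (2 * (n : ℂ) - 2 * (j : ℂ) - 2 * (k : ℂ)) * (Real.pi : ℂ) ^ (2 * j + 2 * k)

end EulerSums

end

/-! Put t = x² and a = πx/2. For fixed d, the generating function of the A_d(2n, d) in powers of t
is the sum over m₁ > … > m_d of ∏ (-1)^{mᵢ} t/(mᵢ² - t), an elementary symmetric function. A second
variable y therefore turns the whole family into ∏_m (1 + y(-1)^m t/(m² - t)). Odd m contribute (1 -
x²(1+y)/m²)/(1 - x²/m²), even m the same with 1 - y, and Euler's products for sine and cosine give
cos(a√(1+y)) · sin(a√(1-y)) / (√(1-y) sin a cos a); this is `hasSum_depthSum`.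

The coefficient of y^c in cos(a√(1+y)) = ∑ (-1)^m a^{2m} (1+y)^m/(2m)! involves m.choose c, a
polynomial in m, hence a combination of the (2m).choose l with l ≤ c. Summing the cosine series
against (2m).choose l gives a^l/l! times the l-th derivative of cos at a. The sine factor is treated
likewise with (2m+1).choose l'.

After division by sin a cos a, each product of derivatives is a constant when l and l' have the same
parity, and otherwise ±cot a or ±tan a. A constant yields only x^{l+l'} with l + l' ≤ d < 2n, which
is invisible at x^{2n}; the Taylor coefficients of cot and tan are even zeta values
(`exists_hasSum_trig`). With c the power of y taken from the cosine, c = 0 gives the first sum of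
the theorem, the tangents the second, and the cotangents with c ≥ 1 the third. -/

namespace EulerSums

open Finset Filter Topology

/-! ### Change of basis from p.choose c to (2p + s).choose l -/

/-- Coefficients expressing `p.choose c` through the binomial coefficients
`(2 * p + s).choose l`, for a shift `s` independent of `p`. -/
noncomputable def halfCoeff (s : ℕ) : ℕ → ℕ → ℝ
  | 0, l => if l = 0 then 1 else 0
  | c + 1, l => ((l : ℝ) / 2 * (halfCoeff s c l + halfCoeff s c (l - 1))
      - (c + (s : ℝ) / 2) * halfCoeff s c l) / (c + 1)

theorem halfCoeff_succ (s c l : ℕ) :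
    halfCoeff s (c + 1) l = ((l : ℝ) / 2 * (halfCoeff s c l + halfCoeff s c (l - 1))
      - (c + (s : ℝ) / 2) * halfCoeff s c l) / (c + 1) := rfl

theorem halfCoeff_eq_zero (s : ℕ) {c l : ℕ} (h : c < l) : halfCoeff s c l = 0 := by
  induction c generalizing l with
  | zero => simp [halfCoeff]; omega
  | succ c ih => rw [halfCoeff_succ, ih (by omega), ih (by omega)]; simp

theorem cast_choose_succ_mul (p c : ℕ) :
    (p.choose (c + 1) : ℝ) * (c + 1) = p.choose c * (p - c) := by
  rcases le_or_gt c p with h | h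
  · have := Nat.choose_succ_right_eq p c
    rw [← Nat.cast_sub h]
    exact_mod_cast this
  · simp [Nat.choose_eq_zero_of_lt h, Nat.choose_eq_zero_of_lt (Nat.lt_succ_of_lt h)]

theorem choose_eq_sum_halfCoeff (s p c : ℕ) :
    (p.choose c : ℝ) = ∑ l ∈ range (c + 1), halfCoeff s c l * ((2 * p + s).choose l : ℝ) := by
  induction c with
  | zero => simp [halfCoeff]
  | succ c ih =>
    have hc : (c : ℝ) + 1 ≠ 0 := by positivity
    have h := cast_choose_succ_mul p c
    rw [← mul_left_inj' hc, h, ih, sum_mul, sum_mul]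
    simp only [halfCoeff_succ]
    -- With N = 2p + s, split p - c = (N - l)/2 + (l/2 - c - s/2); the factor N - l raises l by one
    -- in N.choose l.
    have e1 : ∀ l ∈ range (c + 1), halfCoeff s c l * ((2 * p + s).choose l : ℝ) * (p - c)
        = ((l : ℝ) / 2 - (c + (s : ℝ) / 2)) * halfCoeff s c l * ((2 * p + s).choose l : ℝ)
          + ((l + 1 : ℕ) : ℝ) / 2 * halfCoeff s c l * ((2 * p + s).choose (l + 1) : ℝ) := by
      intro l _
      have := cast_choose_succ_mul (2 * p + s) l
      push_cast at this ⊢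
      linear_combination (-halfCoeff s c l / 2) * this
    rw [sum_congr rfl e1, sum_add_distrib]
    have e2 : ∀ l ∈ range (c + 1 + 1), ((l : ℝ) / 2 * (halfCoeff s c l + halfCoeff s c (l - 1))
        - (c + (s : ℝ) / 2) * halfCoeff s c l) / (c + 1) * ((2 * p + s).choose l : ℝ) * (c + 1)
        = ((l : ℝ) / 2 - (c + (s : ℝ) / 2)) * halfCoeff s c l * ((2 * p + s).choose l : ℝ)
          + (l : ℝ) / 2 * halfCoeff s c (l - 1) * ((2 * p + s).choose l : ℝ) := by
      intro l _
      field_simp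
      ring
    rw [sum_congr rfl e2, sum_add_distrib, sum_range_succ _ (c + 1),
      halfCoeff_eq_zero s (Nat.lt_succ_self c), sum_range_succ' (fun l : ℕ => (l : ℝ) / 2 *
        halfCoeff s c (l - 1) * ((2 * p + s).choose l : ℝ)) (c + 1)]
    simp

/-- With w = √(1+y) - 1, (1+y)^p = (1+w)^{2p+s} (1+y)^{-s/2}, so `halfCoeff s c l` is the
coefficient of y^c in w^l (1+y)^{-s/2}. Lagrange inversion of y = 2w + w² predicts the closed form;
here it is checked against the recursion. -/
theorem halfCoeff_one (k l : ℕ) :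
    halfCoeff 1 (l + k) l = (-1) ^ k * ((l + 2 * k).choose (l + k) : ℝ) * 2 ^ l / 4 ^ (l + k) := by
  suffices H : ∀ c k l : ℕ, c = l + k → halfCoeff 1 c l
      = (-1) ^ k * ((l + 2 * k).choose (l + k) : ℝ) * 2 ^ l / 4 ^ (l + k) from H _ _ _ rfl
  intro c
  induction c with
  | zero =>
    intro k l h
    obtain ⟨rfl, rfl⟩ : l = 0 ∧ k = 0 := by omega
    simp [halfCoeff]
  | succ c ih =>
    intro k l h
    have hc : (c : ℝ) + 1 ≠ 0 := by positivity
    rw [halfCoeff_succ, div_eq_iff hc]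
    rcases k with _ | k
    · obtain rfl : l = c + 1 := by omega
      rw [halfCoeff_eq_zero 1 (Nat.lt_succ_self c), Nat.add_sub_cancel, ih 0 c (by omega)]
      simp only [mul_zero, add_zero, Nat.choose_self]
      rw [pow_succ, pow_succ]
      push_cast
      field_simp
      ring
    · obtain rfl : c = l + k := by omega
      -- All binomials in the recursion are reduced to a common one, by `hB` and, for positive l,
      -- also by `hC`. At l = 0 the truncated neighbour l - 1 is harmless because its factor l
      -- vanishes.
      have hB : ((l + 2 * (k + 1)).choose (l + (k + 1)) : ℝ)
          = (l + 2 * k).choose (l + k) * ((l + 2 * k + 1) * (l + 2 * k + 2) / ((l + k + 1) * (k + 1))) := by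
        have e1 : l + 2 * (k + 1) = (l + (k + 1)) + (k + 1) := by ring
        have e2 : l + 2 * k = (l + k) + k := by ring
        rw [e1, e2, Nat.cast_add_choose, Nat.cast_add_choose, ← e1, ← e2,
          show l + 2 * (k + 1) = l + 2 * k + 1 + 1 by ring, ← add_assoc, Nat.factorial_succ,
          Nat.factorial_succ, Nat.factorial_succ, Nat.factorial_succ]
        push_cast
        field_simp
        ring
      rw [ih k l rfl]
      rcases l with _ | l
      · rw [hB]
        push_cast
        simp only [zero_add]
        rw [pow_succ, pow_succ]
        field_simp
        ring
      · have hC : ((l + 2 * (k + 1)).choose (l + (k + 1)) : ℝ)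
            = (l + 1 + 2 * k).choose (l + 1 + k) * ((l + 2 * k + 2) / (k + 1)) := by
          have e1 : l + 2 * (k + 1) = (l + (k + 1)) + (k + 1) := by ring
          have e2 : l + 1 + 2 * k = (l + 1 + k) + k := by ring
          rw [e1, e2, Nat.cast_add_choose, Nat.cast_add_choose, ← e1, ← e2,
            show l + 2 * (k + 1) = l + 1 + 2 * k + 1 by ring, show l + (k + 1) = l + 1 + k by ring,
            Nat.factorial_succ (l + 1 + 2 * k), Nat.factorial_succ k]
          push_cast
          field_simp
          ring
        rw [Nat.add_sub_cancel, ih (k + 1) l (by omega), hC, hB, ← add_assoc (l + 1) k 1,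
          show l + (k + 1) = l + 1 + k by ring,
          pow_succ _ (l + 1 + k), pow_succ _ k, pow_succ _ l]
        push_cast
        field_simp
        ring

/-- The series (√(1+y) - 1)^0 is constant. This later removes l = 0 from the cotangent terms with c
≥ 1. -/
theorem halfCoeff_zero_zero (c : ℕ) : halfCoeff 0 (c + 1) 0 = 0 := by
  induction c with
  | zero => simp [halfCoeff]
  | succ c ih => rw [halfCoeff_succ, ih]; simp

theorem halfCoeff_zero_succ (k l : ℕ) :
    halfCoeff 0 (l + 1 + k) (l + 1) = (-1) ^ k * (l + 1) / (l + 1 + k)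
      * ((l + 2 * k).choose (l + k) : ℝ) * 2 ^ (l + 1) / 4 ^ (l + 1 + k) := by
  suffices H : ∀ c k l : ℕ, c = l + 1 + k → halfCoeff 0 c (l + 1)
      = (-1) ^ k * (l + 1) / (l + 1 + k)
      * ((l + 2 * k).choose (l + k) : ℝ) * 2 ^ (l + 1) / 4 ^ (l + 1 + k) from H _ _ _ rfl
  intro c
  induction c with
  | zero => intro k l h; omega
  | succ c ih =>
    intro k l h
    have hc : (c : ℝ) + 1 ≠ 0 := by positivity
    rw [halfCoeff_succ, div_eq_iff hc]
    rcases k with _ | k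
    · obtain rfl : l = c := by omega
      rw [halfCoeff_eq_zero 0 (Nat.lt_succ_self l), Nat.add_sub_cancel]
      rcases l with _ | l
      · norm_num [halfCoeff]
      · rw [ih 0 l (by omega)]
        simp only [mul_zero, add_zero, Nat.choose_self]
        rw [pow_succ _ (l + 1), pow_succ _ (l + 1)]
        push_cast
        field_simp
        ring
    · obtain rfl : c = l + 1 + k := by omega
      have hB : ((l + 2 * (k + 1)).choose (l + (k + 1)) : ℝ)
          = (l + 2 * k).choose (l + k) * ((l + 2 * k + 1) * (l + 2 * k + 2) / ((l + k + 1) * (k + 1))) := by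
        have e1 : l + 2 * (k + 1) = (l + (k + 1)) + (k + 1) := by ring
        have e2 : l + 2 * k = (l + k) + k := by ring
        rw [e1, e2, Nat.cast_add_choose, Nat.cast_add_choose, ← e1, ← e2,
          show l + 2 * (k + 1) = l + 2 * k + 1 + 1 by ring, ← add_assoc, Nat.factorial_succ,
          Nat.factorial_succ, Nat.factorial_succ, Nat.factorial_succ]
        push_cast
        field_simp
        ring
      rw [ih k l rfl, Nat.add_sub_cancel]
      rcases l with _ | l
      · rw [hB, show 0 + 1 + k = k + 1 by ring, halfCoeff_zero_zero, zero_add, zero_add,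
          show 1 + (k + 1) = k + 1 + 1 by ring, pow_succ _ (k + 1), pow_succ _ k]
        push_cast
        field_simp
        ring
      · have hC : ((l + 2 * (k + 1)).choose (l + (k + 1)) : ℝ)
            = (l + 1 + 2 * k).choose (l + 1 + k) * ((l + 2 * k + 2) / (k + 1)) := by
          have e1 : l + 2 * (k + 1) = (l + (k + 1)) + (k + 1) := by ring
          have e2 : l + 1 + 2 * k = (l + 1 + k) + k := by ring
          rw [e1, e2, Nat.cast_add_choose, Nat.cast_add_choose, ← e1, ← e2,
            show l + 2 * (k + 1) = l + 1 + 2 * k + 1 by ring, show l + (k + 1) = l + 1 + k by ring,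
            Nat.factorial_succ (l + 1 + 2 * k), Nat.factorial_succ k]
          push_cast
          field_simp
          ring
        rw [ih (k + 1) l (by omega), hC, hB,
          show l + 1 + (k + 1) = l + 1 + k + 1 by ring,
          show l + 1 + 1 + (k + 1) = l + 1 + k + 1 + 1 by ring,
          show l + 1 + 1 + k = l + 1 + k + 1 by ring,
          pow_succ _ (l + 1 + k + 1), pow_succ _ k, pow_succ _ (l + 1)]
        push_cast
        field_simp
        ring

/-! ### Power series: uniqueness of coefficients, products, re-expansion at 1 -/

theorem hasSum_of_eq {ι E : Type*} [AddCommMonoid E] [TopologicalSpace E] {f g : ι → E} {a b : E}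
    (h : HasSum f a) (hfg : ∀ i, g i = f i) (hab : b = a) : HasSum g b := by
  rw [hab, funext hfg]
  exact h

/-- A real power series that sums to zero on a punctured right neighbourhood of `0` vanishes. -/
theorem coeff_eq_zero_of_hasSum_zero {w : ℕ → ℝ} {r : ℝ} (hr : 0 < r)
    (h : ∀ t, 0 < t → t < r → HasSum (fun n => w n * t ^ n) 0) (n : ℕ) : w n = 0 := by
  set p := FormalMultilinearSeries.ofScalars ℝ w with hp
  have hrad : 0 < p.radius := by
    have hs := (h (r / 2) (by linarith) (by linarith)).summable.tendsto_atTop_zero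
    refine lt_of_lt_of_le ?_ (p.le_radius_of_tendsto (r := (r / 2).toNNReal) (l := 0) ?_)
    · simpa using hr
    · have := hs.norm
      simp only [norm_zero] at this
      refine this.congr fun k => ?_
      rw [hp, FormalMultilinearSeries.ofScalars_norm, norm_mul, norm_pow,
        Real.coe_toNNReal _ (by linarith), Real.norm_of_nonneg (by linarith : 0 ≤ r / 2)]
  have hball := p.hasFPowerSeriesOnBall hrad
  -- Zeros accumulating at 0 from the right suffice for the identity theorem.
  have hfa : ∃ᶠ t in 𝓝[≠] (0 : ℝ), p.sum t = 0 := by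
    have hev : ∀ᶠ t in 𝓝[>] (0 : ℝ), p.sum t = 0 := by
      filter_upwards [Ioo_mem_nhdsGT hr] with t ht
      have := (h t ht.1 ht.2).tsum_eq
      rw [← this]
      simp [FormalMultilinearSeries.sum, hp, mul_comm]
    exact (hev.frequently).filter_mono (nhdsWithin_mono _ fun x hx => ne_of_gt hx)
  have hz := hball.analyticAt.frequently_zero_iff_eventually_zero.1 hfa
  have h0 := (hball.hasFPowerSeriesAt.congr hz).eq_zero
  have := FormalMultilinearSeries.ofScalars_series_eq_zero (𝕜 := ℝ) (E := ℝ) (c := w)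
  exact congrFun (this.1 h0) n

/-- Positive arguments are enough, which matters because t is a square x² with x > 0. -/
theorem coeff_eq_of_hasSum {u v : ℕ → ℝ} {f : ℝ → ℝ} {r : ℝ} (hr : 0 < r)
    (hu : ∀ t, 0 < t → t < r → HasSum (fun n => u n * t ^ n) (f t))
    (hv : ∀ t, 0 < t → t < r → HasSum (fun n => v n * t ^ n) (f t)) (n : ℕ) : u n = v n := by
  refine sub_eq_zero.1 (coeff_eq_zero_of_hasSum_zero (w := fun n => u n - v n) hr ?_ n)
  intro t h0 h1
  simpa only [sub_mul, sub_self] using (hu t h0 h1).sub (hv t h0 h1)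

theorem hasSum_prod_pi {β : Type*} {d : ℕ} {g : Fin d → β → ℝ} {s : Fin d → ℝ}
    (h : ∀ i, HasSum (g i) (s i)) :
    HasSum (fun x : Fin d → β => ∏ i, g i (x i)) (∏ i, s i) := by
  induction d with
  | zero =>
    simp only [univ_eq_empty, prod_empty]
    exact hasSum_unique (fun _ : Fin 0 → β => (1 : ℝ))
  | succ d ih =>
    have h1 := ih (g := fun i => g i.succ) (s := fun i => s i.succ) fun i => h i.succ
    have h2 := summable_mul_of_summable_norm (f := g 0)
      (g := fun x : Fin d → β => ∏ i : Fin d, g i.succ (x i)) (h 0).summable.norm h1.summable.norm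
    have h3 := HasSum.mul (f := g 0) (g := fun x : Fin d → β => ∏ i : Fin d, g i.succ (x i))
      (h 0) h1 h2
    have h4 : (fun x : Fin (d + 1) → β => ∏ i, g i (x i)) ∘ (Fin.consEquiv fun _ => β)
        = fun x : β × (Fin d → β) => g 0 x.1 * ∏ i : Fin d, g i.succ (x.2 i) := by
      funext x
      simp [Fin.prod_univ_succ, Fin.consEquiv]
    rw [Fin.prod_univ_succ, ← (Fin.consEquiv fun _ => β).hasSum_iff, h4]
    exact h3

/-- If `∑ uₘ 2ᵐ` converges absolutely, then `∑ uₘ (1 + y)ᵐ` may be expanded in powers of `y`. -/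
theorem hasSum_binomial_expansion {u : ℕ → ℝ} {U : ℕ → ℝ} {y v : ℝ} (hy : |y| ≤ 1)
    (hu : Summable fun m => |u m| * 2 ^ m)
    (hU : ∀ c, HasSum (fun m => u m * (m.choose c : ℝ)) (U c))
    (hv : HasSum (fun m => u m * (1 + y) ^ m) v) :
    HasSum (fun c => U c * y ^ c) v := by
  have hrow : ∀ (z : ℝ) (m : ℕ), HasSum (fun c => u m * (m.choose c : ℝ) * z ^ c)
      (u m * (1 + z) ^ m) := by
    intro z m
    have : u m * (1 + z) ^ m = ∑ c ∈ range (m + 1), u m * (m.choose c : ℝ) * z ^ c := by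
      rw [add_comm, add_pow, mul_sum]
      refine sum_congr rfl fun c _ => ?_
      simp; ring
    rw [this]
    refine hasSum_sum_of_ne_finset_zero fun c hc => ?_
    rw [mem_range, not_lt] at hc
    simp [Nat.choose_eq_zero_of_lt hc]
  have hnorm : ∀ m c, |u m * (m.choose c : ℝ) * y ^ c| = |u m| * (m.choose c : ℝ) * |y| ^ c := by
    intro m c; rw [abs_mul, abs_mul, abs_pow, Nat.abs_cast]
  have hrow' : ∀ m, HasSum (fun c => |u m| * (m.choose c : ℝ) * |y| ^ c)
      (|u m| * (1 + |y|) ^ m) := by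
    intro m
    rcases le_total 0 (u m) with h | h
    · simpa [abs_of_nonneg h] using hrow |y| m
    · simpa [abs_of_nonpos h] using (hrow |y| m).neg
  have hsum : Summable fun p : ℕ × ℕ => u p.1 * (p.1.choose p.2 : ℝ) * y ^ p.2 := by
    refine Summable.of_norm ?_
    refine (summable_prod_of_nonneg fun p => norm_nonneg _).2 ⟨fun m => ?_, ?_⟩
    · simp only [Real.norm_eq_abs, hnorm]
      exact (hrow' m).summable
    · simp only [Real.norm_eq_abs, hnorm, fun m => (hrow' m).tsum_eq]
      refine hu.of_nonneg_of_le (fun m => by positivity) fun m => ?_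
      gcongr
      linarith
  have h1 : HasSum (fun p : ℕ × ℕ => u p.1 * (p.1.choose p.2 : ℝ) * y ^ p.2) v := by
    have := hsum.hasSum.prod_fiberwise fun m => hrow y m
    rw [← this.unique hv]
    exact hsum.hasSum
  have h2 := ((Equiv.prodComm ℕ ℕ).hasSum_iff.2 h1)
  exact h2.prod_fiberwise fun c => by simpa using (hU c).mul_right (y ^ c)

/-! ### Expansion of cos(a√(1+y)) and sin(a√(1+y))/√(1+y) in y -/

theorem hasSum_exp_mul_choose (z : ℂ) (l : ℕ) :
    HasSum (fun m : ℕ => z ^ m / (m.factorial : ℂ) * (m.choose l : ℂ))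
      (z ^ l / (l.factorial : ℂ) * Complex.exp z) := by
  have h := NormedSpace.expSeries_div_hasSum_exp (𝔸 := ℂ) z
  rw [← Complex.exp_eq_exp_ℂ] at h
  rw [← hasSum_nat_add_iff' l]
  have h0 : ∑ m ∈ range l, z ^ m / (m.factorial : ℂ) * (m.choose l : ℂ) = 0 :=
    sum_eq_zero fun m hm => by simp [Nat.choose_eq_zero_of_lt (mem_range.1 hm)]
  rw [h0, sub_zero]
  refine hasSum_of_eq (h.mul_left (z ^ l / (l.factorial : ℂ))) (fun m => ?_) rfl
  rw [← Nat.choose_symm_add, Nat.cast_add_choose, pow_add]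
  have : ((m + l).factorial : ℂ) ≠ 0 := by exact_mod_cast Nat.factorial_ne_zero _
  have : (m.factorial : ℂ) ≠ 0 := by exact_mod_cast Nat.factorial_ne_zero _
  have : (l.factorial : ℂ) ≠ 0 := by exact_mod_cast Nat.factorial_ne_zero _
  field_simp

theorem I_pow_mul_exp (a : ℝ) (l : ℕ) :
    Complex.I ^ l * Complex.exp (a * Complex.I)
      = Complex.exp (((a + l * (Real.pi / 2) : ℝ) : ℂ) * Complex.I) := by
  nth_rw 1 [← Complex.exp_pi_div_two_mul_I]
  rw [← Complex.exp_nat_mul, ← Complex.exp_add]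
  congr 1
  push_cast
  ring

/-- This is a^l/l! times the l-th derivative of exp(ia), each derivative adding π/2 to the phase.
Real and imaginary parts then select even and odd m. -/
theorem hasSum_trig_mul_choose (a : ℝ) (l : ℕ) :
    HasSum (fun m : ℕ => ((Complex.I ^ m * ((a ^ m / (m.factorial : ℝ) * (m.choose l : ℝ) : ℝ) : ℂ))))
      (((a ^ l / (l.factorial : ℝ) : ℝ) : ℂ)
        * Complex.exp (((a + l * (Real.pi / 2) : ℝ) : ℂ) * Complex.I)) := by
  rw [← I_pow_mul_exp]
  refine hasSum_of_eq (hasSum_exp_mul_choose (a * Complex.I) l) (fun m => ?_) ?_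
  · push_cast
    ring
  · push_cast
    ring

theorem hasSum_cos_mul_choose (a : ℝ) (l : ℕ) :
    HasSum (fun m : ℕ => (-1) ^ m * a ^ (2 * m) / ((2 * m).factorial : ℝ) * ((2 * m).choose l : ℝ))
      (a ^ l / (l.factorial : ℝ) * Real.cos (a + l * (Real.pi / 2))) := by
  have h := Complex.hasSum_re (hasSum_trig_mul_choose a l)
  rw [Complex.re_ofReal_mul, Complex.exp_ofReal_mul_I_re] at h
  have hinj : Function.Injective fun m : ℕ => 2 * m := fun a b h => by simpa using h
  rw [← hinj.hasSum_iff] at h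
  · convert h using 2 with m
    simp only [Function.comp, pow_mul, Complex.I_sq]
    rw [show ((-1 : ℂ)) ^ m = (((-1 : ℝ) ^ m : ℝ) : ℂ) by push_cast; rfl, Complex.re_ofReal_mul,
      Complex.ofReal_re]
    ring
  · intro m hm
    have hodd : Odd m := by
      rw [← Nat.not_even_iff_odd]
      rintro ⟨k, rfl⟩
      exact hm ⟨k, by simp; ring⟩
    obtain ⟨k, rfl⟩ := hodd
    rw [pow_succ, pow_mul, Complex.I_sq, mul_comm, Complex.re_ofReal_mul,
      show ((-1 : ℂ)) ^ k = (((-1 : ℝ) ^ k : ℝ) : ℂ) by push_cast; rfl, Complex.re_ofReal_mul]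
    simp

theorem hasSum_sin_mul_choose (a : ℝ) (l : ℕ) :
    HasSum (fun m : ℕ => (-1) ^ m * a ^ (2 * m + 1) / ((2 * m + 1).factorial : ℝ)
        * ((2 * m + 1).choose l : ℝ))
      (a ^ l / (l.factorial : ℝ) * Real.sin (a + l * (Real.pi / 2))) := by
  have h := Complex.hasSum_im (hasSum_trig_mul_choose a l)
  rw [Complex.im_ofReal_mul, Complex.exp_ofReal_mul_I_im] at h
  have hinj : Function.Injective fun m : ℕ => 2 * m + 1 := fun a b h => by simpa using h
  rw [← hinj.hasSum_iff] at h
  · convert h using 2 with m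
    simp only [Function.comp, pow_succ _ (2 * m), pow_mul, Complex.I_sq]
    rw [mul_assoc, show ((-1 : ℂ)) ^ m = (((-1 : ℝ) ^ m : ℝ) : ℂ) by push_cast; rfl,
      Complex.im_ofReal_mul, Complex.im_mul_ofReal, Complex.I_im]
    ring
  · intro m hm
    have heven : Even m := by
      rw [← Nat.not_odd_iff_even]
      rintro ⟨k, rfl⟩
      exact hm ⟨k, rfl⟩
    obtain ⟨k, rfl⟩ := heven
    rw [← two_mul, pow_mul, Complex.I_sq,
      show ((-1 : ℂ)) ^ k = (((-1 : ℝ) ^ k : ℝ) : ℂ) by push_cast; rfl, Complex.im_ofReal_mul,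
      Complex.ofReal_im, mul_zero]

/-- The coefficient of `y ^ c` in `cos (a * √(1 + y))`. -/
noncomputable def cosCoeff (a : ℝ) (c : ℕ) : ℝ :=
  ∑ l ∈ range (c + 1), halfCoeff 0 c l * (a ^ l / (l.factorial : ℝ) * Real.cos (a + l * (Real.pi / 2)))

/-- The coefficient of `y ^ c` in `sin (a * √(1 + y)) / √(1 + y)`. -/
noncomputable def sinCoeff (a : ℝ) (c : ℕ) : ℝ :=
  ∑ l ∈ range (c + 1), halfCoeff 1 c l * (a ^ l / (l.factorial : ℝ) * Real.sin (a + l * (Real.pi / 2)))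

theorem hasSum_cosCoeff (a : ℝ) (c : ℕ) :
    HasSum (fun m : ℕ => (-1) ^ m * a ^ (2 * m) / ((2 * m).factorial : ℝ) * (m.choose c : ℝ))
      (cosCoeff a c) := by
  have h := hasSum_sum (s := range (c + 1)) fun l _ =>
    (hasSum_cos_mul_choose a l).mul_left (halfCoeff 0 c l)
  refine hasSum_of_eq h (fun m => ?_) rfl
  rw [choose_eq_sum_halfCoeff 0, mul_sum]
  exact sum_congr rfl fun l _ => by rw [add_zero]; ring

theorem hasSum_sinCoeff (a : ℝ) (c : ℕ) :
    HasSum (fun m : ℕ => (-1) ^ m * a ^ (2 * m + 1) / ((2 * m + 1).factorial : ℝ)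
      * (m.choose c : ℝ)) (sinCoeff a c) := by
  have h := hasSum_sum (s := range (c + 1)) fun l _ =>
    (hasSum_sin_mul_choose a l).mul_left (halfCoeff 1 c l)
  refine hasSum_of_eq h (fun m => ?_) rfl
  rw [choose_eq_sum_halfCoeff 1, mul_sum]
  exact sum_congr rfl fun l _ => by ring

theorem hasSum_cos_sqrt (a : ℝ) {y : ℝ} (hy : |y| < 1) :
    HasSum (fun c => cosCoeff a c * y ^ c) (Real.cos (a * √(1 + y))) := by
  have key : ∀ z : ℝ, 0 ≤ z → HasSum (fun m : ℕ => (-1) ^ m * a ^ (2 * m) / ((2 * m).factorial : ℝ)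
      * z ^ m) (Real.cos (a * √z)) := by
    intro z hz
    refine hasSum_of_eq (Real.hasSum_cos (a * √z)) (fun m => ?_) rfl
    rw [mul_pow, pow_mul √z, Real.sq_sqrt hz]
    ring
  refine hasSum_binomial_expansion hy.le ?_ (hasSum_cosCoeff a)
    (key _ (by linarith [neg_abs_le y]))
  -- The absolute convergence with weights 2^m is that of the same series at z = 2.
  refine (key 2 (by norm_num)).summable.norm.congr fun m => ?_
  rw [norm_mul, Real.norm_eq_abs, norm_pow, Real.norm_of_nonneg (by norm_num : (0:ℝ) ≤ 2)]

theorem hasSum_sin_sqrt (a : ℝ) {y : ℝ} (hy : |y| < 1) :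
    HasSum (fun c => sinCoeff a c * y ^ c) (Real.sin (a * √(1 + y)) / √(1 + y)) := by
  have key : ∀ z : ℝ, 0 < z → HasSum (fun m : ℕ => (-1) ^ m * a ^ (2 * m + 1)
      / ((2 * m + 1).factorial : ℝ) * z ^ m) (Real.sin (a * √z) / √z) := by
    intro z hz
    refine hasSum_of_eq ((Real.hasSum_sin (a * √z)).div_const √z) (fun m => ?_) rfl
    have : √z ≠ 0 := (Real.sqrt_pos.2 hz).ne'
    rw [mul_pow, pow_succ √z, pow_mul √z, Real.sq_sqrt hz.le]
    field_simp
  refine hasSum_binomial_expansion hy.le ?_ (hasSum_sinCoeff a)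
    (key _ (by linarith [(abs_lt.1 hy).1]))
  refine (key 2 (by norm_num)).summable.norm.congr fun m => ?_
  rw [norm_mul, Real.norm_eq_abs, norm_pow, Real.norm_of_nonneg (by norm_num : (0:ℝ) ≤ 2)]

/-- Cauchy product in y; the sine is expanded at -y, whence the sign. -/
theorem hasSum_cos_mul_sin (a : ℝ) {y : ℝ} (hy : |y| < 1) :
    HasSum (fun d => (∑ p ∈ antidiagonal d, cosCoeff a p.1 * ((-1) ^ p.2 * sinCoeff a p.2)) * y ^ d)
      (Real.cos (a * √(1 + y)) * (Real.sin (a * √(1 - y)) / √(1 - y))) := by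
  have h1 := hasSum_cos_sqrt a hy
  have h2 := hasSum_sin_sqrt a (y := -y) (by simpa using hy)
  rw [← sub_eq_add_neg] at h2
  have hs := summable_norm_sum_mul_antidiagonal_of_summable_norm h1.summable.norm h2.summable.norm
  have ht := tsum_mul_tsum_eq_tsum_sum_antidiagonal_of_summable_norm h1.summable.norm
    h2.summable.norm
  rw [h1.tsum_eq, h2.tsum_eq] at ht
  rw [ht]
  refine hasSum_of_eq hs.of_norm.hasSum (fun d => ?_) rfl
  rw [sum_mul]
  refine sum_congr rfl fun p hp => ?_
  rw [← mem_antidiagonal.1 hp, neg_pow, pow_add]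
  ring

/-! ### Generating function in t at fixed depth -/

theorem summable_one_div_pnat_sq : Summable fun m : ℕ+ => 1 / ((m : ℕ) : ℝ) ^ 2 :=
  (Real.summable_one_div_nat_pow.2 one_lt_two).comp_injective PNat.coe_injective

theorem one_le_pnat_cast (m : ℕ+) : (1 : ℝ) ≤ ((m : ℕ) : ℝ) := by exact_mod_cast (one_le : 1 ≤ m)

theorem hasSum_geometric_pnat {t : ℝ} (h0 : 0 ≤ t) (h1 : t < 1) (m : ℕ+) :
    HasSum (fun j : ℕ => (t / ((m : ℕ) : ℝ) ^ 2) ^ (j + 1)) (t / (((m : ℕ) : ℝ) ^ 2 - t)) := by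
  have hm : (1 : ℝ) ≤ ((m : ℕ) : ℝ) ^ 2 := one_le_pow₀ (one_le_pnat_cast m)
  have hlt : t / ((m : ℕ) : ℝ) ^ 2 < 1 := by rw [div_lt_one (by linarith)]; linarith
  refine hasSum_of_eq ((hasSum_geometric_of_lt_one (by positivity) hlt).mul_left
    (t / ((m : ℕ) : ℝ) ^ 2)) (fun j => pow_succ' _ _) ?_
  have : ((m : ℕ) : ℝ) ^ 2 - t ≠ 0 := by linarith
  have : (1 - t / ((m : ℕ) : ℝ) ^ 2) ≠ 0 := by linarith
  field_simp

/-- Dominated by t^j/m², since t < 1 and m ≥ 1. -/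
theorem summable_geometric_pnat {t : ℝ} (h0 : 0 ≤ t) (h1 : t < 1) :
    Summable fun p : ℕ+ × ℕ => (t / ((p.1 : ℕ) : ℝ) ^ 2) ^ (p.2 + 1) := by
  have h := summable_mul_of_summable_norm (f := fun m : ℕ+ => 1 / ((m : ℕ) : ℝ) ^ 2)
    (g := fun j : ℕ => t ^ j) summable_one_div_pnat_sq.norm
    (summable_geometric_of_lt_one h0 h1).norm
  refine h.of_nonneg_of_le (fun p => by positivity) fun p => ?_
  have hm : (1 : ℝ) ≤ ((p.1 : ℕ) : ℝ) ^ 2 := one_le_pow₀ (one_le_pnat_cast p.1)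
  rw [pow_succ', div_pow]
  gcongr
  exact div_le_self (by positivity) (one_le_pow₀ hm)

/-- The coefficient of `t ^ j` in `(-1) ^ m * t / (m ^ 2 - t)`. -/
noncomputable def altCoeff (m : ℕ+) (j : ℕ) : ℝ :=
  if j = 0 then 0 else (-1) ^ (m : ℕ) / ((m : ℕ) : ℝ) ^ (2 * j)

noncomputable def altTerm (t : ℝ) (m : ℕ+) : ℝ := (-1) ^ (m : ℕ) * (t / (((m : ℕ) : ℝ) ^ 2 - t))

theorem altCoeff_succ_mul (m : ℕ+) (j : ℕ) (t : ℝ) : altCoeff m (j + 1) * t ^ (j + 1)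
    = (-1) ^ (m : ℕ) * (t / ((m : ℕ) : ℝ) ^ 2) ^ (j + 1) := by
  rw [altCoeff, if_neg (Nat.succ_ne_zero j), div_pow, ← pow_mul]
  ring

theorem hasSum_altCoeff {t : ℝ} (h0 : 0 ≤ t) (h1 : t < 1) (m : ℕ+) :
    HasSum (fun j : ℕ => altCoeff m j * t ^ j) (altTerm t m) := by
  rw [← hasSum_nat_add_iff' 1]
  refine hasSum_of_eq ((hasSum_geometric_pnat h0 h1 m).mul_left ((-1) ^ (m : ℕ)))
    (fun j => altCoeff_succ_mul m j t) ?_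
  simp [altCoeff, altTerm]

theorem summable_altCoeff {t : ℝ} (h0 : 0 ≤ t) (h1 : t < 1) :
    Summable fun p : ℕ+ × ℕ => altCoeff p.1 p.2 * t ^ p.2 := by
  have hinj : Function.Injective fun p : ℕ+ × ℕ => (p.1, p.2 + 1) := by
    rintro ⟨a, b⟩ ⟨c, d⟩ h
    simpa using h
  rw [← hinj.summable_iff]
  · refine Summable.of_norm_bounded (summable_geometric_pnat h0 h1) fun p => ?_
    simp only [Function.comp, altCoeff_succ_mul]
    rw [norm_mul, norm_pow, norm_neg, norm_one, one_pow, one_mul, Real.norm_of_nonneg (by positivity)]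
  · rintro ⟨m, j⟩ h
    rcases j with _ | j
    · simp [altCoeff]
    · exact absurd ⟨(m, j), rfl⟩ h

/-- The generating function of the totally alternating sums of depth `d`. -/
noncomputable def depthSum (d : ℕ) (t : ℝ) : ℝ := ∑' m : Index d, ∏ i, altTerm t (m.1 i)

theorem signs_self (d : ℕ) : signs d d = {fun _ => -1} := by
  ext ε
  simp only [signs, mem_filter, mem_univ, true_and, mem_singleton]
  constructor
  · intro h
    have := (card_eq_iff_eq_univ _).1 (h.trans (Fintype.card_fin d).symm)
    funext i
    have hi : i ∈ univ.filter fun i => ε i = -1 := by rw [this]; exact mem_univ i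
    exact (mem_filter.1 hi).2
  · rintro rfl
    simp

theorem summable_term {d : ℕ} (s : Fin d → ℕ) (hs : ∀ i, 2 ≤ s i) (ε : Fin d → ℤˣ) :
    Summable (term s ε) := by
  have h := (hasSum_prod_pi (g := fun (_ : Fin d) (m : ℕ+) => 1 / ((m : ℕ) : ℝ) ^ 2)
    fun _ => summable_one_div_pnat_sq.hasSum).summable
  refine Summable.of_norm_bounded (h.comp_injective Subtype.val_injective) fun m => ?_
  rw [term, norm_prod]
  refine prod_le_prod (fun i _ => norm_nonneg _) fun i _ => ?_
  have hε : ‖(((ε i : ℤˣ) : ℤ) : ℝ)‖ = 1 := by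
    rcases Int.units_eq_one_or (ε i) with h | h <;> simp [h]
  rw [norm_div, norm_pow, hε, one_pow, norm_pow, Real.norm_of_nonneg (by positivity)]
  exact one_div_le_one_div_of_le (pow_pos (by linarith [one_le_pnat_cast (m.1 i)]) 2)
    (pow_le_pow_right₀ (one_le_pnat_cast _) (hs i))

/-- The joint expansion of `∏ i, altTerm t (m i)` over exponents `j` and indices `m`. -/
noncomputable def altMonomial {d : ℕ} (t : ℝ) (m : Fin d → ℕ+) (j : Fin d → ℕ) : ℝ :=
  ∏ i, altCoeff (m i) (j i) * t ^ (j i)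

theorem summable_altMonomial (d : ℕ) {t : ℝ} (h0 : 0 ≤ t) (h1 : t < 1) :
    Summable fun p : Index d × (Fin d → ℕ) => altMonomial t p.1.1 p.2 := by
  have h : Summable fun x : Fin d → ℕ+ × ℕ => ∏ i, altCoeff (x i).1 (x i).2 * t ^ (x i).2 :=
    (hasSum_prod_pi (g := fun (_ : Fin d) (p : ℕ+ × ℕ) => altCoeff p.1 p.2 * t ^ p.2)
      (s := fun _ => ∑' p : ℕ+ × ℕ, altCoeff p.1 p.2 * t ^ p.2)
      fun _ => (summable_altCoeff h0 h1).hasSum).summable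
  have hinj : Function.Injective
      fun (p : Index d × (Fin d → ℕ)) (i : Fin d) => (p.1.1 i, p.2 i) := by
    rintro ⟨m, j⟩ ⟨m', j'⟩ h
    have h' := fun i => Prod.ext_iff.1 (congrFun h i)
    exact Prod.ext (Subtype.ext (funext fun i => (h' i).1)) (funext fun i => (h' i).2)
  have h2 := h.comp_injective hinj
  rw [Function.comp_def] at h2
  exact h2

theorem hasSum_altMonomial (d : ℕ) {t : ℝ} (h0 : 0 ≤ t) (h1 : t < 1) :
    HasSum (fun p : Index d × (Fin d → ℕ) => altMonomial t p.1.1 p.2) (depthSum d t) := by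
  have hS := summable_altMonomial d h0 h1
  have hrow : ∀ m : Index d, HasSum (fun j : Fin d → ℕ => altMonomial t m.1 j)
      (∏ i, altTerm t (m.1 i)) :=
    fun m => hasSum_prod_pi (g := fun i j => altCoeff (m.1 i) j * t ^ j)
      (s := fun i => altTerm t (m.1 i)) fun i => hasSum_altCoeff h0 h1 (m.1 i)
  rw [depthSum, (hS.hasSum.prod_fiberwise hrow).tsum_eq]
  exact hS.hasSum

theorem altMonomial_of_pos {d : ℕ} (t : ℝ) (m : Index d) {j : Fin d → ℕ} (hpos : ∀ i, 0 < j i) :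
    altMonomial t m.1 j = term (fun i => 2 * j i) (fun _ => -1) m * t ^ (∑ i, j i) := by
  rw [altMonomial, term, ← prod_pow_eq_pow_sum, ← prod_mul_distrib]
  refine prod_congr rfl fun i _ => ?_
  simp [altCoeff, (hpos i).ne']

/-- The totally alternating sum `ζ(2j₁, …, 2j_d; -1, …, -1)`, set to `0` if some `jᵢ = 0`. -/
noncomputable def altSum {d : ℕ} (j : Fin d → ℕ) : ℝ :=
  if ∀ i, 0 < j i then eulerSum (fun i => 2 * j i) (fun _ => -1) else 0

/-- t/(m² - t) has no constant term, so tuples with a zero entry contribute nothing and the sum may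
run over all tuples. -/
theorem hasSum_altMonomial_index {d : ℕ} (t : ℝ) (j : Fin d → ℕ) :
    HasSum (fun m : Index d => altMonomial t m.1 j) (altSum j * t ^ (∑ i, j i)) := by
  by_cases hpos : ∀ i, 0 < j i
  · rw [altSum, if_pos hpos]
    refine hasSum_of_eq (((summable_term (fun i => 2 * j i) (fun i => ?_) _).hasSum).mul_right _)
      (fun m => altMonomial_of_pos t m hpos) rfl
    have := hpos i
    omega
  · rw [altSum, if_neg hpos, zero_mul]
    push Not at hpos
    obtain ⟨i, hi⟩ := hpos
    have e : ∀ m : Index d, altMonomial t m.1 j = 0 := fun m =>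
      prod_eq_zero (mem_univ i) (by simp [altCoeff, Nat.le_zero.1 hi])
    simp only [e]
    exact hasSum_zero

theorem sum_altSum (n d : ℕ) : ∑ j ∈ Finset.Nat.antidiagonalTuple d n, altSum j = A d n d := by
  simp only [A, compositions, signs_self, sum_filter, sum_singleton, altSum]

/-- The double series over indices m and exponents j converges absolutely. Summing over j first
gives `depthSum`; summing over m first and collecting the j of total n gives the coefficient of t^n.
-/
theorem hasSum_A (d : ℕ) {t : ℝ} (h0 : 0 ≤ t) (h1 : t < 1) :
    HasSum (fun n => A d n d * t ^ n) (depthSum d t) := by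
  have h2 := ((Equiv.prodComm (Fin d → ℕ) (Index d)).hasSum_iff.2
    (hasSum_altMonomial d h0 h1)).prod_fiberwise fun j => hasSum_altMonomial_index t j
  rw [← (Finset.Nat.sigmaAntidiagonalTupleEquivTuple d).hasSum_iff] at h2
  refine h2.sigma fun n => ?_
  refine hasSum_of_eq ((Finset.Nat.antidiagonalTuple d n).hasSum fun j => altSum j * t ^ n)
    (fun j => ?_) ?_
  · obtain ⟨j, hj⟩ := j
    simp [Finset.Nat.sigmaAntidiagonalTupleEquivTuple, Finset.Nat.mem_antidiagonalTuple.1 hj]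
  · rw [← sum_mul, sum_altSum]

/-! ### Infinite product in y -/

/-- Strictly decreasing `d`-tuples of positive integers correspond to `d`-element sets. -/
def indexEquiv (d : ℕ) : Index d ≃ Set.powersetCard ℕ+ d :=
  (Equiv.mk (fun m => OrderEmbedding.ofStrictMono (fun i => m.1 i.rev)
      fun _ _ h => m.2 (Fin.rev_lt_rev.2 h))
    (fun f => ⟨fun i => f i.rev, fun _ _ h => f.strictMono (Fin.rev_lt_rev.2 h)⟩)
    (fun m => Subtype.ext (funext fun i => congrArg m.1 (Fin.rev_rev i)))
    (fun f => RelEmbedding.ext fun i => congrArg f (Fin.rev_rev i)) : Index d ≃ (Fin d ↪o ℕ+)).trans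
    Set.powersetCard.ofFinEmbEquiv

theorem prod_indexEquiv {d : ℕ} (f : ℕ+ → ℝ) (m : Index d) :
    ∏ n ∈ (indexEquiv d m).1, f n = ∏ i, f (m.1 i) := by
  have h : (indexEquiv d m).1 = univ.map ⟨m.1, m.2.injective⟩ := by
    ext n
    rw [Finset.mem_map]
    have := Set.powersetCard.mem_ofFinEmbEquiv_iff_mem_range (OrderEmbedding.ofStrictMono
      (fun i => m.1 i.rev) fun _ _ h => m.2 (Fin.rev_lt_rev.2 h)) n
    refine Iff.trans this ?_
    constructor
    · rintro ⟨i, rfl⟩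
      exact ⟨i.rev, mem_univ _, rfl⟩
    · rintro ⟨i, _, rfl⟩
      exact ⟨i.rev, congrArg m.1 (Fin.rev_rev i)⟩
  rw [h, prod_map]
  rfl

theorem summable_altTerm {t : ℝ} (h0 : 0 ≤ t) (h1 : t < 1 / 4) : Summable fun m => ‖altTerm t m‖ := by
  refine summable_one_div_pnat_sq.of_nonneg_of_le (fun m => norm_nonneg _) fun m => ?_
  have hm : (1 : ℝ) ≤ ((m : ℕ) : ℝ) ^ 2 := one_le_pow₀ (one_le_pnat_cast m)
  have hd : 0 < ((m : ℕ) : ℝ) ^ 2 - t := by linarith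
  rw [altTerm, norm_mul, norm_pow, norm_neg, norm_one, one_pow, one_mul,
    Real.norm_of_nonneg (by positivity), div_le_div_iff₀ hd (by linarith)]
  nlinarith

/-- The product `∏ (1 + y * altTerm t m)` is the generating function of the `depthSum d t`. -/
theorem exists_hasProd_depthSum {t : ℝ} (h0 : 0 ≤ t) (h1 : t < 1 / 4) (y : ℝ) :
    ∃ P : ℝ, HasProd (fun m : ℕ+ => 1 + y * altTerm t m) P ∧
      HasSum (fun d => depthSum d t * y ^ d) P := by
  have hs : Summable fun m => ‖y * altTerm t m‖ := by
    simpa only [norm_mul] using (summable_altTerm h0 h1).mul_left ‖y‖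
  have hS := (summable_finsetProd_of_summable_norm hs).hasSum
  refine ⟨_, hasProd_one_add_of_hasSum_prod hS, ?_⟩
  -- The expanded product is a sum over finite sets of positive integers; grouping by cardinality d
  -- isolates y^d.
  have h2 := Set.powersetCard.prodEquiv.hasSum_iff.2 hS
  have hsum := h2.summable
  refine h2.sigma fun d => ?_
  have hd := (hsum.sigma_factor d).hasSum
  rw [← (indexEquiv d).hasSum_iff] at hd
  have e : ∀ m : Index d, ∏ i, altTerm t (m.1 i) * y =
      ∏ n ∈ (indexEquiv d m).1, y * altTerm t n := by
    intro m
    rw [prod_indexEquiv]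
    exact prod_congr rfl fun i _ => mul_comm _ _
  have hd2 := (indexEquiv d).hasSum_iff.1 hd
  refine hasSum_of_eq hd2 (fun _ => rfl) ?_
  rw [← (indexEquiv d).tsum_eq, depthSum, ← tsum_mul_right]
  refine tsum_congr fun m => ?_
  have hpow : y ^ d = ∏ _i : Fin d, y := by simp
  rw [hpow, ← prod_mul_distrib]
  exact e m

/-! ### Evaluation of the product by Euler's formulas -/

theorem prod_range_two_mul (g : ℕ → ℝ) (N : ℕ) :
    ∏ n ∈ range (2 * N), g n = (∏ k ∈ range N, g (2 * k)) * ∏ k ∈ range N, g (2 * k + 1) := by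
  induction N with
  | zero => simp
  | succ N ih =>
    rw [show 2 * (N + 1) = 2 * N + 1 + 1 by ring, prod_range_succ, prod_range_succ, ih,
      prod_range_succ, prod_range_succ]
    ring

theorem sin_pi_mul_pos {w : ℝ} (h0 : 0 < w) (h1 : w < 1) : 0 < Real.sin (Real.pi * w) :=
  Real.sin_pos_of_pos_of_lt_pi (by positivity) (by nlinarith [Real.pi_pos])

theorem cos_pi_mul_pos {w : ℝ} (h0 : 0 < w) (h1 : w < 1 / 2) : 0 < Real.cos (Real.pi * w) :=
  Real.cos_pos_of_mem_Ioo ⟨by nlinarith [Real.pi_pos], by nlinarith [Real.pi_pos]⟩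

theorem tendsto_sin_prod {w : ℝ} (h0 : 0 < w) :
    Tendsto (fun N : ℕ => ∏ k ∈ range N, (1 - w ^ 2 / ((k : ℝ) + 1) ^ 2)) atTop
      (𝓝 (Real.sin (Real.pi * w) / (Real.pi * w))) := by
  have hw : Real.pi * w ≠ 0 := by positivity
  refine ((Real.tendsto_euler_sin_prod w).div_const (Real.pi * w)).congr fun N => ?_
  field_simp

/-- Use cos q = sin 2q/(2 sin q) with q = πw/2: among the first 2N factors of the sine product at w,
the even denominators form the product at w/2, leaving the odd ones. -/
theorem tendsto_cos_prod {w : ℝ} (h0 : 0 < w) (h1 : w < 1) :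
    Tendsto (fun N : ℕ => ∏ k ∈ range N, (1 - w ^ 2 / (2 * (k : ℝ) + 1) ^ 2)) atTop
      (𝓝 (Real.cos (Real.pi * (w / 2)))) := by
  have hs := (sin_pi_mul_pos (half_pos h0) (by linarith)).ne'
  have hne : Real.sin (Real.pi * (w / 2)) / (Real.pi * (w / 2)) ≠ 0 :=
    div_ne_zero hs (by positivity)
  have h2 : Tendsto (fun N : ℕ => 2 * N) atTop atTop :=
    tendsto_id.const_mul_atTop' two_pos
  have h := ((tendsto_sin_prod h0).comp h2).div (tendsto_sin_prod (half_pos h0)) hne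
  have hval : Real.sin (Real.pi * w) / (Real.pi * w)
      / (Real.sin (Real.pi * (w / 2)) / (Real.pi * (w / 2))) = Real.cos (Real.pi * (w / 2)) := by
    rw [show Real.pi * w = 2 * (Real.pi * (w / 2)) by ring, Real.sin_two_mul]
    have hq : Real.pi * (w / 2) ≠ 0 := by positivity
    generalize Real.pi * (w / 2) = q at hs hq
    field_simp
  rw [hval] at h
  refine h.congr fun N => ?_
  simp only [Pi.div_apply, Function.comp]
  rw [prod_range_two_mul, div_eq_iff]
  · congr 1
    · refine prod_congr rfl fun k _ => ?_
      push_cast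
      ring
    · refine prod_congr rfl fun k _ => ?_
      push_cast
      field_simp
      ring
  · refine prod_ne_zero_iff.2 fun k _ => ?_
    have hk : (1 : ℝ) ≤ ((k : ℝ) + 1) ^ 2 := one_le_pow₀ (by linarith [Nat.cast_nonneg (α := ℝ) k])
    have : (w / 2) ^ 2 / ((k : ℝ) + 1) ^ 2 < 1 := by
      rw [div_lt_one (by linarith)]
      nlinarith
    linarith

theorem hasSum_depthSum {x y : ℝ} (h0 : 0 < x) (h1 : x < 1 / 2) (hy : |y| < 1) :
    HasSum (fun d => depthSum d (x ^ 2) * y ^ d)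
      (Real.cos (Real.pi * x / 2 * √(1 + y)) * (Real.sin (Real.pi * x / 2 * √(1 - y)) / √(1 - y))
        / (Real.sin (Real.pi * x / 2) * Real.cos (Real.pi * x / 2))) := by
  obtain ⟨P, hP, hS⟩ := exists_hasProd_depthSum (sq_nonneg x) (by nlinarith) y
  have hy' := abs_lt.1 hy
  have hr : 0 < √(1 + y) := Real.sqrt_pos.2 (by linarith)
  have hs : 0 < √(1 - y) := Real.sqrt_pos.2 (by linarith)
  have hr2 : √(1 + y) ^ 2 = 1 + y := Real.sq_sqrt (by linarith)
  have hs2 : √(1 - y) ^ 2 = 1 - y := Real.sq_sqrt (by linarith)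
  have hr3 : √(1 + y) < 2 := by nlinarith
  have hs3 : √(1 - y) < 2 := by nlinarith
  have hPN : HasProd (fun n : ℕ => 1 + y * altTerm (x ^ 2) n.succPNat) P :=
    (Equiv.pnatEquivNat.symm.hasProd_iff).2 hP
  have hlim := hPN.tendsto_prod_nat.comp
    (tendsto_id.const_mul_atTop' two_pos : Tendsto (fun N : ℕ => 2 * N) atTop atTop)
  have hsx := (sin_pi_mul_pos (half_pos h0) (by linarith)).ne'
  have hcx := (cos_pi_mul_pos (half_pos h0) (by linarith)).ne'
  have hlim2 := ((tendsto_sin_prod (w := x * √(1 - y) / 2) (by positivity)).div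
    (tendsto_sin_prod (half_pos h0)) (div_ne_zero hsx (by positivity))).mul
    ((tendsto_cos_prod (w := x * √(1 + y)) (by positivity) (by nlinarith)).div
    (tendsto_cos_prod h0 (by linarith)) hcx)
  have hPeq := tendsto_nhds_unique hlim (hlim2.congr fun N => ?_)
  · refine hasSum_of_eq hS (fun _ => rfl) ?_
    rw [hPeq, show Real.pi * x / 2 * √(1 + y) = Real.pi * (x * √(1 + y) / 2) by ring,
      show Real.pi * x / 2 * √(1 - y) = Real.pi * (x * √(1 - y) / 2) by ring,
      show Real.pi * x / 2 = Real.pi * (x / 2) by ring]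
    field_simp
  · simp only [Pi.div_apply, Function.comp]
    -- Position k stands for m = k + 1, so even k carry the sign -1 and build the cosine quotient,
    -- odd k the sine quotient at half argument.
    rw [prod_range_two_mul, mul_comm, ← prod_div_distrib, ← prod_div_distrib]
    have hk0 : ∀ k : ℕ, (0 : ℝ) ≤ k := fun k => Nat.cast_nonneg k
    congr 1
    · refine prod_congr rfl fun k _ => ?_
      have hk := hk0 k
      have e1 : (2 * (k : ℝ) + 1) ^ 2 - x ^ 2 ≠ 0 := by nlinarith
      have e2 : (2 * (k : ℝ) + 1) ≠ 0 := by positivity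
      have e3 : 1 - x ^ 2 / (2 * (k : ℝ) + 1) ^ 2 ≠ 0 := by
        rw [one_sub_div (by positivity)]; exact div_ne_zero e1 (by positivity)
      rw [altTerm, mul_pow, hr2, Nat.succPNat_coe]
      rw [show (-1 : ℝ) ^ (2 * k).succ = -1 by rw [pow_succ, pow_mul]; norm_num]
      push_cast
      rw [div_eq_iff e3]
      field_simp
      ring
    · refine prod_congr rfl fun k _ => ?_
      have hk := hk0 k
      have e1 : (2 * (k : ℝ) + 1 + 1) ^ 2 - x ^ 2 ≠ 0 := by nlinarith
      have e2 : ((k : ℝ) + 1) ≠ 0 := by positivity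
      have e4 : ((k : ℝ) + 1) ^ 2 - (x / 2) ^ 2 ≠ 0 := by nlinarith
      have e3 : 1 - (x / 2) ^ 2 / ((k : ℝ) + 1) ^ 2 ≠ 0 := by
        rw [one_sub_div (by positivity)]; exact div_ne_zero e4 (by positivity)
      rw [altTerm, div_pow, mul_pow, hs2, Nat.succPNat_coe]
      rw [show (-1 : ℝ) ^ (2 * k + 1).succ = 1 by
        rw [show (2 * k + 1).succ = 2 * (k + 1) by omega, pow_mul]; norm_num]
      push_cast
      rw [div_eq_iff e3]
      field_simp
      ring

/-! ### Even zeta values and the cotangent series -/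

/-- The zeta value `ζ(2n)` as a real number. -/
noncomputable def evenZeta (n : ℕ) : ℝ := ∑' m : ℕ+, 1 / ((m : ℕ) : ℝ) ^ (2 * n)

theorem riemannZeta_two_mul {n : ℕ} (hn : n ≠ 0) :
    riemannZeta (2 * (n : ℂ)) = ((evenZeta n : ℝ) : ℂ) := by
  have h := zeta_nat_eq_tsum_of_gt_one (k := 2 * n) (by omega)
  push_cast at h
  rw [h, evenZeta, Complex.ofReal_tsum]
  have h2 := PNat.coe_injective.tsum_eq (f := fun m : ℕ => 1 / (m : ℂ) ^ (2 * n)) fun m hm =>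
    ⟨⟨m, Nat.pos_of_ne_zero fun h0 => hm (by simp [h0, hn])⟩, rfl⟩
  rw [← h2]
  push_cast
  rfl

/-- The Taylor coefficients of `π x cot (π x)` in powers of `x ^ 2`. -/
noncomputable def cotCoeff (n : ℕ) : ℝ := if n = 0 then 1 else -2 * evenZeta n

theorem hasSum_evenZeta {t : ℝ} (h0 : 0 ≤ t) (h1 : t < 1) :
    HasSum (fun j => evenZeta (j + 1) * t ^ (j + 1))
      (∑' m : ℕ+, t / (((m : ℕ) : ℝ) ^ 2 - t)) := by
  have hS := summable_geometric_pnat h0 h1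
  have h2 := hS.hasSum.prod_fiberwise fun m => hasSum_geometric_pnat h0 h1 m
  rw [h2.tsum_eq]
  have h3 := (Equiv.prodComm ℕ ℕ+).hasSum_iff.2 hS.hasSum
  refine h3.prod_fiberwise fun j => ?_
  have hj : Summable fun m : ℕ+ => 1 / ((m : ℕ) : ℝ) ^ (2 * (j + 1)) :=
    (Real.summable_one_div_nat_pow.2 (by omega)).comp_injective PNat.coe_injective
  refine hasSum_of_eq (hj.hasSum.mul_right (t ^ (j + 1))) (fun m => ?_) rfl
  simp only [Function.comp, Equiv.prodComm_apply, Prod.swap, div_pow, ← pow_mul]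
  ring

/-- Mittag-Leffler expansion of the cotangent: the poles ±m pair to -2x/(m² - x²), which expands as
a geometric series. -/
theorem hasSum_cotCoeff {x : ℝ} (h0 : 0 < x) (h1 : x < 1) :
    HasSum (fun n => cotCoeff n * (x ^ 2) ^ n)
      (Real.pi * x * (Real.cos (Real.pi * x) / Real.sin (Real.pi * x))) := by
  have hx : (x : ℂ) ∈ Complex.integerComplement := by
    rintro ⟨k, hk⟩
    have hk' : (k : ℝ) = x := by exact_mod_cast hk
    rw [← hk'] at h0 h1
    have a : 0 < k := by exact_mod_cast h0
    have b : k < 1 := by exact_mod_cast h1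
    omega
  have ht : x ^ 2 < 1 := by nlinarith
  have hc := cot_series_rep hx
  have hterm : ∀ m : ℕ+, 1 / ((x : ℂ) - (m : ℕ)) + 1 / ((x : ℂ) + (m : ℕ))
      = ((-2 / x * (x ^ 2 / (((m : ℕ) : ℝ) ^ 2 - x ^ 2)) : ℝ) : ℂ) := by
    intro m
    have hm := one_le_pnat_cast m
    have e1 : x - (m : ℕ) ≠ 0 := by linarith
    have e2 : x + (m : ℕ) ≠ 0 := by linarith
    have e3 : ((m : ℕ) : ℝ) ^ 2 - x ^ 2 ≠ 0 := by nlinarith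
    rw [show 1 / ((x : ℂ) - (m : ℕ)) + 1 / ((x : ℂ) + (m : ℕ))
      = ((1 / (x - (m : ℕ)) + 1 / (x + (m : ℕ)) : ℝ) : ℂ) by push_cast; rfl]
    congr 1
    field_simp
    ring
  have hreal : Real.pi * (Real.cos (Real.pi * x) / Real.sin (Real.pi * x))
      = 1 / x + -2 / x * ∑' m : ℕ+, x ^ 2 / (((m : ℕ) : ℝ) ^ 2 - x ^ 2) := by
    rw [← tsum_mul_left]
    have hc' : ((Real.pi * (Real.cos (Real.pi * x) / Real.sin (Real.pi * x)) : ℝ) : ℂ)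
        = ((1 / x + ∑' m : ℕ+, -2 / x * (x ^ 2 / (((m : ℕ) : ℝ) ^ 2 - x ^ 2)) : ℝ) : ℂ) := by
      rw [Complex.ofReal_add, Complex.ofReal_tsum]
      simp only [← hterm]
      rw [Complex.cot] at hc
      push_cast
      exact hc
    exact_mod_cast hc'
  rw [← hasSum_nat_add_iff' 1]
  refine hasSum_of_eq ((hasSum_evenZeta (sq_nonneg x) ht).mul_left (-2)) (fun j => ?_) ?_
  · rw [cotCoeff, if_neg (Nat.succ_ne_zero j)]; ring
  · rw [show Real.pi * x * (Real.cos (Real.pi * x) / Real.sin (Real.pi * x))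
      = x * (Real.pi * (Real.cos (Real.pi * x) / Real.sin (Real.pi * x))) by ring, hreal]
    simp only [sum_range_one, cotCoeff, if_true, pow_zero]
    field_simp
    ring

/-! ### Coefficients of the trigonometric quotients -/

theorem cos_add_even (a : ℝ) (j : ℕ) :
    Real.cos (a + (2 * j : ℕ) * (Real.pi / 2)) = (-1) ^ j * Real.cos a := by
  rw [← Real.cos_add_nat_mul_pi]
  congr 1; push_cast; ring

theorem cos_add_odd (a : ℝ) (j : ℕ) :
    Real.cos (a + (2 * j + 1 : ℕ) * (Real.pi / 2)) = -((-1) ^ j * Real.sin a) := by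
  rw [← mul_neg, ← Real.cos_add_pi_div_two, ← Real.cos_add_nat_mul_pi]
  congr 1; push_cast; ring

theorem sin_add_even (a : ℝ) (j : ℕ) :
    Real.sin (a + (2 * j : ℕ) * (Real.pi / 2)) = (-1) ^ j * Real.sin a := by
  rw [← Real.sin_add_nat_mul_pi]
  congr 1; push_cast; ring

theorem sin_add_odd (a : ℝ) (j : ℕ) :
    Real.sin (a + (2 * j + 1 : ℕ) * (Real.pi / 2)) = (-1) ^ j * Real.cos a := by
  rw [← Real.sin_add_pi_div_two, ← Real.sin_add_nat_mul_pi]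
  congr 1; push_cast; ring

theorem hasSum_mul_cot {x : ℝ} (h0 : 0 < x) (h1 : x < 1 / 2) :
    HasSum (fun n => cotCoeff n / 4 ^ n * (x ^ 2) ^ n)
      (Real.pi * x / 2 * (Real.cos (Real.pi * x / 2) / Real.sin (Real.pi * x / 2))) := by
  refine hasSum_of_eq (hasSum_cotCoeff (half_pos h0) (by linarith)) (fun n => ?_) ?_
  · rw [div_pow x, div_pow (x ^ 2)]
    norm_num
    ring
  · rw [show Real.pi * x / 2 = Real.pi * (x / 2) by ring]

/-- Follows from tan q = cot q - 2 cot 2q with q = πx/2. -/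
theorem hasSum_mul_tan {x : ℝ} (h0 : 0 < x) (h1 : x < 1 / 2) :
    HasSum (fun n => cotCoeff n * (1 / 4 ^ n - 1) * (x ^ 2) ^ n)
      (Real.pi * x / 2 * (Real.sin (Real.pi * x / 2) / Real.cos (Real.pi * x / 2))) := by
  refine hasSum_of_eq ((hasSum_mul_cot h0 h1).sub (hasSum_cotCoeff h0 (by linarith)))
    (fun n => by ring) ?_
  have hs := (sin_pi_mul_pos (half_pos h0) (by linarith)).ne'
  have hc := (cos_pi_mul_pos (half_pos h0) (by linarith)).ne'
  have hx : Real.pi * x = 2 * (Real.pi * (x / 2)) := by ring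
  rw [hx, Real.sin_two_mul, Real.cos_two_mul', mul_div_cancel_left₀ _ two_ne_zero]
  generalize Real.pi * (x / 2) = q at hs hc
  field_simp
  ring

theorem hasSum_shift {u : ℕ → ℝ} {t s : ℝ} (J : ℕ) (h : HasSum (fun n => u n * t ^ n) s) :
    HasSum (fun n => (if n < J then 0 else u (n - J)) * t ^ n) (t ^ J * s) := by
  rw [← hasSum_nat_add_iff' J]
  refine hasSum_of_eq (h.mul_left (t ^ J)) (fun n => ?_) ?_
  · rw [if_neg (by omega), Nat.add_sub_cancel, pow_add]
    ring
  · rw [sum_eq_zero fun i hi => by rw [if_pos (mem_range.1 hi), zero_mul], sub_zero]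

theorem hasSum_monomial (J : ℕ) (t : ℝ) :
    HasSum (fun n => (if n = J then 1 else 0) * t ^ n) (t ^ J) := by
  refine hasSum_of_eq (hasSum_ite_eq J (t ^ J)) (fun n => ?_) rfl
  split_ifs with h
  · rw [h, one_mul]
  · rw [zero_mul]

/-- For `n` large compared to `l + l'`, the coefficient of `x ^ (2 * n)` in
`a ^ (l + l') * cos (a + l * π / 2) * sin (a + l' * π / 2) / (sin a * cos a)`, where
`a = π * x / 2`. -/
noncomputable def trigCoeff (l l' n : ℕ) : ℝ :=
  if Even l then
    if Even l' then 0
    else -2 * (-1) ^ (l / 2 + l' / 2) * Real.pi ^ (2 * (l / 2 + l' / 2)) / 4 ^ n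
      * evenZeta (n - (l / 2 + l' / 2))
  else
    if Even l' then -2 * (-1) ^ (l / 2 + l' / 2) * Real.pi ^ (2 * (l / 2 + l' / 2))
      * (1 / 4 ^ (l / 2 + l' / 2) - 1 / 4 ^ n) * evenZeta (n - (l / 2 + l' / 2))
    else 0

/-- Equal parities leave a single power of x², of exponent (l + l')/2, discarded by the bound on n.
Even l with odd l' leaves ±cot, odd l with even l' leaves ±tan; there the bound makes n - (j + k)
positive, so the exceptional constant term of `cotCoeff` is never met. -/
theorem exists_hasSum_trig (l l' : ℕ) : ∃ u : ℕ → ℝ,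
    (∀ x : ℝ, 0 < x → x < 1 / 2 → HasSum (fun n => u n * (x ^ 2) ^ n)
      ((Real.pi * x / 2) ^ (l + l') * (Real.cos (Real.pi * x / 2 + l * (Real.pi / 2))
        * Real.sin (Real.pi * x / 2 + l' * (Real.pi / 2)))
        / (Real.sin (Real.pi * x / 2) * Real.cos (Real.pi * x / 2)))) ∧
    ∀ n, (l + l') / 2 < n → u n = trigCoeff l l' n := by
  have hpos : ∀ x : ℝ, 0 < x → x < 1 / 2 →
      Real.sin (Real.pi * x / 2) ≠ 0 ∧ Real.cos (Real.pi * x / 2) ≠ 0 := by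
    intro x h0 h1
    rw [show Real.pi * x / 2 = Real.pi * (x / 2) by ring]
    exact ⟨(sin_pi_mul_pos (half_pos h0) (by linarith)).ne',
      (cos_pi_mul_pos (half_pos h0) (by linarith)).ne'⟩
  have hpi := Real.pi_ne_zero
  obtain ⟨j, rfl | rfl⟩ := Nat.even_or_odd' l <;> obtain ⟨k, rfl | rfl⟩ := Nat.even_or_odd' l'
  · refine ⟨fun n => (-1) ^ (j + k) * (Real.pi ^ 2 / 4) ^ (j + k)
      * if n = j + k then 1 else 0, fun x h0 h1 => ?_, fun n hn => ?_⟩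
    · obtain ⟨hs, hc⟩ := hpos x h0 h1
      refine hasSum_of_eq ((hasSum_monomial (j + k) (x ^ 2)).mul_left
        ((-1) ^ (j + k) * (Real.pi ^ 2 / 4) ^ (j + k))) (fun n => by ring) ?_
      rw [cos_add_even, sin_add_even, mul_assoc _ _ ((x ^ 2) ^ (j + k)), ← mul_pow,
        show Real.pi ^ 2 / 4 * x ^ 2 = (Real.pi * x / 2) ^ 2 by ring, ← pow_mul]
      generalize Real.pi * x / 2 = a at hs hc
      field_simp
      ring
    · have : n ≠ j + k := by omega
      simp [trigCoeff, this]
  · refine ⟨fun n => (-1) ^ (j + k) * (Real.pi ^ 2 / 4) ^ (j + k)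
      * if n < j + k then 0 else cotCoeff (n - (j + k)) / 4 ^ (n - (j + k)),
      fun x h0 h1 => ?_, fun n hn => ?_⟩
    · obtain ⟨hs, hc⟩ := hpos x h0 h1
      refine hasSum_of_eq ((hasSum_shift (u := fun n => cotCoeff n / 4 ^ n) (j + k)
        (hasSum_mul_cot h0 h1)).mul_left
        ((-1) ^ (j + k) * (Real.pi ^ 2 / 4) ^ (j + k))) (fun n => by ring) ?_
      rw [cos_add_even, sin_add_odd, mul_assoc _ _ ((x ^ 2) ^ (j + k) * _),
        ← mul_assoc _ ((x ^ 2) ^ (j + k)), ← mul_pow,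
        show Real.pi ^ 2 / 4 * x ^ 2 = (Real.pi * x / 2) ^ 2 by ring, ← pow_mul]
      generalize Real.pi * x / 2 = a at hs hc
      field_simp
      ring
    · obtain ⟨p, rfl⟩ : ∃ p, n = j + k + p := ⟨n - (j + k), by omega⟩
      have h1 : ¬ j + k + p < j + k := by omega
      have h2 : ¬ Even (2 * k + 1) := by simp
      have h3 : (2 * k + 1) / 2 = k := by omega
      have h4 : 2 * j / 2 = j := by omega
      have h5 : p ≠ 0 := by omega
      simp only [trigCoeff, h1, h2, h3, h4, if_false, even_two_mul, if_true, cotCoeff, h5,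
        Nat.add_sub_cancel_left]
      rw [div_pow, ← pow_mul, pow_add 4 (j + k) p]
      field_simp
  · refine ⟨fun n => -((-1) ^ (j + k) * (Real.pi ^ 2 / 4) ^ (j + k))
      * if n < j + k then 0 else cotCoeff (n - (j + k)) * (1 / 4 ^ (n - (j + k)) - 1),
      fun x h0 h1 => ?_, fun n hn => ?_⟩
    · obtain ⟨hs, hc⟩ := hpos x h0 h1
      refine hasSum_of_eq ((hasSum_shift (u := fun n => cotCoeff n * (1 / 4 ^ n - 1)) (j + k)
        (hasSum_mul_tan h0 h1)).mul_left
        (-((-1) ^ (j + k) * (Real.pi ^ 2 / 4) ^ (j + k)))) (fun n => by ring) ?_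
      rw [cos_add_odd, sin_add_even, neg_mul (_ * _) ((x ^ 2) ^ (j + k) * _),
        mul_assoc _ _ ((x ^ 2) ^ (j + k) * _),
        ← mul_assoc _ ((x ^ 2) ^ (j + k)), ← mul_pow,
        show Real.pi ^ 2 / 4 * x ^ 2 = (Real.pi * x / 2) ^ 2 by ring, ← pow_mul]
      generalize Real.pi * x / 2 = a at hs hc
      field_simp
      ring
    · obtain ⟨p, rfl⟩ : ∃ p, n = j + k + p := ⟨n - (j + k), by omega⟩
      have h1 : ¬ j + k + p < j + k := by omega
      have h2 : ¬ Even (2 * j + 1) := by simp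
      have h3 : (2 * j + 1) / 2 = j := by omega
      have h4 : 2 * k / 2 = k := by omega
      have h5 : p ≠ 0 := by omega
      simp only [trigCoeff, h1, h2, h3, h4, if_false, even_two_mul, if_true, cotCoeff, h5,
        Nat.add_sub_cancel_left]
      rw [div_pow, ← pow_mul, pow_add 4 (j + k) p]
      field_simp
      ring
  · refine ⟨fun n => -((-1) ^ (j + k) * (Real.pi ^ 2 / 4) ^ (j + k + 1))
      * if n = j + k + 1 then 1 else 0, fun x h0 h1 => ?_, fun n hn => ?_⟩
    · obtain ⟨hs, hc⟩ := hpos x h0 h1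
      refine hasSum_of_eq ((hasSum_monomial (j + k + 1) (x ^ 2)).mul_left
        (-((-1) ^ (j + k) * (Real.pi ^ 2 / 4) ^ (j + k + 1)))) (fun n => by ring) ?_
      rw [cos_add_odd, sin_add_odd, neg_mul (_ * _) ((x ^ 2) ^ (j + k + 1)),
        mul_assoc _ _ ((x ^ 2) ^ (j + k + 1)), ← mul_pow,
        show Real.pi ^ 2 / 4 * x ^ 2 = (Real.pi * x / 2) ^ 2 by ring, ← pow_mul]
      generalize Real.pi * x / 2 = a at hs hc
      field_simp
      ring
    · have h1 : n ≠ j + k + 1 := by omega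
      have h2 : ¬ Even (2 * j + 1) := by simp
      have h3 : ¬ Even (2 * k + 1) := by simp
      simp only [trigCoeff, h1, h2, h3, if_false, mul_zero]

/-! ### Extraction of the coefficients of y^d and t^n -/

theorem depthSum_eq {x : ℝ} (h0 : 0 < x) (h1 : x < 1 / 2) (d : ℕ) :
    depthSum d (x ^ 2) = (∑ p ∈ antidiagonal d, cosCoeff (Real.pi * x / 2) p.1
      * ((-1) ^ p.2 * sinCoeff (Real.pi * x / 2) p.2))
        / (Real.sin (Real.pi * x / 2) * Real.cos (Real.pi * x / 2)) := by
  refine coeff_eq_of_hasSum (u := fun d => depthSum d (x ^ 2))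
    (v := fun d => (∑ p ∈ antidiagonal d, cosCoeff (Real.pi * x / 2) p.1
      * ((-1) ^ p.2 * sinCoeff (Real.pi * x / 2) p.2))
        / (Real.sin (Real.pi * x / 2) * Real.cos (Real.pi * x / 2)))
    one_pos (fun y hy0 hy1 => hasSum_depthSum h0 h1 (abs_lt.2 ⟨by linarith, hy1⟩))
    (fun y hy0 hy1 => ?_) d
  refine hasSum_of_eq ((hasSum_cos_mul_sin (Real.pi * x / 2)
    (abs_lt.2 ⟨by linarith, hy1⟩)).div_const _) (fun d => ?_) rfl
  ring

theorem A_eq_sum_trigCoeff {n d : ℕ} (hd : 1 ≤ d) (hdn : d ≤ n) :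
    A d n d = ∑ p ∈ antidiagonal d, (-1) ^ p.2 * ∑ l ∈ range (p.1 + 1), ∑ l' ∈ range (p.2 + 1),
      halfCoeff 0 p.1 l * halfCoeff 1 p.2 l' / (l.factorial * l'.factorial) * trigCoeff l l' n := by
  choose u hu hu' using exists_hasSum_trig
  have key := coeff_eq_of_hasSum (u := fun n => A d n d)
    (v := fun n => ∑ p ∈ antidiagonal d, (-1) ^ p.2 * ∑ l ∈ range (p.1 + 1),
      ∑ l' ∈ range (p.2 + 1),
      halfCoeff 0 p.1 l * halfCoeff 1 p.2 l' / (l.factorial * l'.factorial) * u l l' n)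
    (f := depthSum d) (r := 1 / 4) (by norm_num)
    (fun t ht0 ht1 => hasSum_A d ht0.le (by linarith)) (fun t ht0 ht1 => ?_) n
  · rw [key]
    refine sum_congr rfl fun p hp => ?_
    congr 1
    refine sum_congr rfl fun l hl => sum_congr rfl fun l' hl' => ?_
    -- l + l' ≤ d ≤ n with d ≥ 1 gives (l + l')/2 < n.
    rw [hu']
    have := mem_antidiagonal.1 hp
    have := mem_range.1 hl
    have := mem_range.1 hl'
    omega
  · obtain ⟨x, hx0, rfl⟩ : ∃ x : ℝ, 0 < x ∧ x ^ 2 = t :=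
      ⟨√t, Real.sqrt_pos.2 ht0, Real.sq_sqrt ht0.le⟩
    -- The radius 1/4 in t is exactly the condition x < 1/2 of the trigonometric expansions.
    have hx1 : x < 1 / 2 := by nlinarith
    have h := hasSum_sum (s := antidiagonal d) fun p _ =>
      (hasSum_sum (s := range (p.1 + 1)) fun l _ =>
        hasSum_sum (s := range (p.2 + 1)) fun l' _ => (hu l l' x hx0 hx1).mul_left
          (halfCoeff 0 p.1 l * halfCoeff 1 p.2 l' / (l.factorial * l'.factorial))).mul_left
          ((-1) ^ p.2)
    refine hasSum_of_eq h (fun m => ?_) ?_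
    · rw [sum_mul]
      refine sum_congr rfl fun p _ => ?_
      rw [mul_assoc, sum_mul]
      congr 1
      refine sum_congr rfl fun l _ => ?_
      rw [sum_mul]
      exact sum_congr rfl fun l' _ => by ring
    · rw [depthSum_eq hx0 hx1, sum_div]
      refine sum_congr rfl fun p _ => ?_
      rw [cosCoeff, sinCoeff, mul_left_comm, sum_mul_sum, mul_div_assoc, sum_div]
      congr 1
      refine sum_congr rfl fun l _ => ?_
      rw [sum_div]
      refine sum_congr rfl fun l' _ => ?_
      rw [pow_add]
      have : (l.factorial : ℝ) ≠ 0 := by positivity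
      have : (l'.factorial : ℝ) ≠ 0 := by positivity
      field_simp

/-! ### Closed forms by parity and assembly of the three sums -/

theorem halfCoeff_one_even {b k : ℕ} (h : 2 * k ≤ b) :
    halfCoeff 1 b (2 * k) = (-1) ^ b * ((2 * b - 2 * k).choose b : ℝ) * 4 ^ k / 4 ^ b := by
  obtain ⟨r, rfl⟩ := Nat.exists_eq_add_of_le h
  rw [halfCoeff_one, show 2 * (2 * k + r) - 2 * k = 2 * k + 2 * r by omega, pow_add (-1),
    pow_mul (-1), pow_mul 2]
  norm_num

theorem halfCoeff_one_odd {b k : ℕ} (h : 2 * k + 1 ≤ b) : halfCoeff 1 b (2 * k + 1)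
    = -((-1) ^ b * ((2 * b - 2 * k - 1).choose b : ℝ) * (2 * 4 ^ k) / 4 ^ b) := by
  obtain ⟨r, rfl⟩ := Nat.exists_eq_add_of_le h
  rw [halfCoeff_one, show 2 * (2 * k + 1 + r) - 2 * k - 1 = 2 * k + 1 + 2 * r by omega,
    pow_add (-1), pow_succ (-1) (2 * k), pow_mul (-1), pow_succ 2, pow_mul 2]
  norm_num
  ring

theorem halfCoeff_zero_even {c j : ℕ} (hj : 1 ≤ j) (h : 2 * j ≤ c) : halfCoeff 0 c (2 * j)
    = (-1) ^ c * (2 * j / c) * ((2 * c - 2 * j - 1).choose (c - 1) : ℝ) * 4 ^ j / 4 ^ c := by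
  obtain ⟨r, rfl⟩ := Nat.exists_eq_add_of_le h
  obtain ⟨i, rfl⟩ := Nat.exists_eq_add_of_le' hj
  rw [show 2 * (i + 1) = 2 * i + 1 + 1 by ring, halfCoeff_zero_succ,
    show 2 * (2 * i + 1 + 1 + r) - (2 * i + 1 + 1) - 1 = 2 * i + 1 + 2 * r by omega,
    show 2 * i + 1 + 1 + r - 1 = 2 * i + 1 + r by omega,
    show 2 * i + 1 + 1 = 2 * (i + 1) by ring, pow_add (-1), pow_mul (-1), pow_mul 2, neg_one_sq, one_pow,
    show (2 : ℝ) ^ 2 = 4 by norm_num]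
  push_cast
  ring

theorem halfCoeff_zero_odd {c j : ℕ} (h : 2 * j + 1 ≤ c) : halfCoeff 0 c (2 * j + 1)
    = -((-1) ^ c * ((2 * j + 1) / c) * ((2 * c - 2 * j - 2).choose (c - 1) : ℝ) * (2 * 4 ^ j)
      / 4 ^ c) := by
  obtain ⟨r, rfl⟩ := Nat.exists_eq_add_of_le h
  rw [halfCoeff_zero_succ,
    show 2 * (2 * j + 1 + r) - 2 * j - 2 = 2 * j + 2 * r by omega,
    show 2 * j + 1 + r - 1 = 2 * j + r by omega,
    pow_add (-1), pow_succ (-1), pow_mul (-1), pow_succ 2, pow_mul 2]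
  push_cast
  norm_num
  ring

theorem sum_range_succ_parity (g : ℕ → ℝ) (N : ℕ) : ∑ l ∈ range (N + 1), g l
    = ∑ j ∈ range (N / 2 + 1), g (2 * j) + ∑ j ∈ range ((N + 1) / 2), g (2 * j + 1) := by
  induction N with
  | zero => simp
  | succ N ih =>
    rw [sum_range_succ, ih]
    obtain ⟨M, rfl | rfl⟩ := Nat.even_or_odd' N
    · rw [show (2 * M + 1 + 1) / 2 = M + 1 by omega, show (2 * M + 1) / 2 = M by omega,
        show 2 * M / 2 = M by omega, sum_range_succ _ M, sum_range_succ _ M]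
      ring
    · rw [show (2 * M + 1 + 1 + 1) / 2 = M + 1 by omega, show (2 * M + 1 + 1) / 2 = M + 1 by omega,
        show (2 * M + 1) / 2 = M by omega, sum_range_succ _ (M + 1),
        show 2 * (M + 1) = 2 * M + 1 + 1 by ring]
      ring

theorem sum_Icc_one (f : ℕ → ℝ) (N : ℕ) : ∑ c ∈ Icc 1 N, f c = ∑ c ∈ range N, f (c + 1) := by
  induction N with
  | zero => simp
  | succ N ih => rw [sum_Icc_succ_top (by omega), ih, sum_range_succ]

theorem trigCoeff_even_even (j k n : ℕ) : trigCoeff (2 * j) (2 * k) n = 0 := by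
  simp [trigCoeff]

theorem trigCoeff_odd_odd (j k n : ℕ) : trigCoeff (2 * j + 1) (2 * k + 1) n = 0 := by
  have h2 : ¬ Even (2 * j + 1) := by simp
  have h3 : ¬ Even (2 * k + 1) := by simp
  simp only [trigCoeff, h2, h3, if_false]

theorem trigCoeff_even_odd (j k n : ℕ) : trigCoeff (2 * j) (2 * k + 1) n
    = -2 * ((-1) ^ (j + k) * Real.pi ^ (2 * j + 2 * k)) / 4 ^ n * evenZeta (n - j - k) := by
  have h2 : ¬ Even (2 * k + 1) := by simp
  simp only [trigCoeff, h2, even_two_mul, if_true, if_false]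
  rw [show 2 * j / 2 = j by omega, show (2 * k + 1) / 2 = k by omega, mul_add, Nat.sub_sub]
  ring

theorem trigCoeff_odd_even (j k n : ℕ) : trigCoeff (2 * j + 1) (2 * k) n
    = -2 * ((-1) ^ (j + k) * Real.pi ^ (2 * j + 2 * k)) * (1 / 4 ^ (j + k) - 1 / 4 ^ n)
      * evenZeta (n - j - k) := by
  have h2 : ¬ Even (2 * j + 1) := by simp
  simp only [trigCoeff, h2, even_two_mul, if_true, if_false]
  rw [show 2 * k / 2 = k by omega, show (2 * j + 1) / 2 = j by omega, mul_add, Nat.sub_sub]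
  ring

theorem neg_one_pow_mul_self (b : ℕ) : (-1 : ℝ) ^ b * (-1) ^ b = 1 := by
  rw [← mul_pow]; norm_num

/-- For c = 0 only l = 0 occurs, so only odd l' survive: these are cotangent terms. -/
theorem sum_depth_zero_term (n d : ℕ) :
    (-1) ^ d * ∑ l ∈ range (0 + 1), ∑ l' ∈ range (d + 1),
      halfCoeff 0 0 l * halfCoeff 1 d l' / (l.factorial * l'.factorial) * trigCoeff l l' n
    = ∑ j ∈ range ((d + 1) / 2), (-1) ^ j * (4 * 4 ^ j / (4 ^ n * 4 ^ d))
      / ((2 * j + 1).factorial : ℝ) * ((2 * d - 2 * j - 1).choose d : ℝ)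
      * evenZeta (n - j) * Real.pi ^ (2 * j) := by
  rw [zero_add, sum_range_one, sum_range_succ_parity, mul_add, mul_sum, mul_sum,
    sum_eq_zero fun k _ => by
      rw [← mul_zero 2, trigCoeff_even_even, mul_zero, mul_zero], zero_add]
  refine sum_congr rfl fun j hj => ?_
  have hj' : 2 * j + 1 ≤ d := by have := mem_range.1 hj; omega
  have ht := trigCoeff_even_odd 0 j n
  rw [mul_zero] at ht
  rw [ht, halfCoeff_one_odd hj', halfCoeff, if_pos rfl, Nat.sub_zero, zero_add, zero_add,
    Nat.factorial_zero, Nat.cast_one, one_mul, one_mul]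
  have hs := neg_one_pow_mul_self d
  generalize (-1 : ℝ) ^ d = s at hs
  have : ((2 * j + 1).factorial : ℝ) ≠ 0 := by positivity
  field_simp
  linear_combination 4 * ((2 * d - 2 * j - 1).choose d : ℝ) * evenZeta (n - j) * hs

theorem odd_even_term {n d c j k : ℕ} (hc : 1 ≤ c) (hcd : c ≤ d) (hj : 2 * j + 1 ≤ c)
    (hk : 2 * k ≤ d - c) :
    (-1) ^ (d - c) * (halfCoeff 0 c (2 * j + 1) * halfCoeff 1 (d - c) (2 * k)
      / ((2 * j + 1).factorial * (2 * k).factorial) * trigCoeff (2 * j + 1) (2 * k) n)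
    = (-1) ^ (c + j + k) * (1 - 4 ^ j * 4 ^ k / 4 ^ n)
        / ((c : ℝ) * ((2 * j).factorial : ℝ) * ((2 * k).factorial : ℝ) * 4 ^ (d - 1))
      * ((2 * c - 2 * j - 2).choose (c - 1) : ℝ) * ((2 * d - 2 * c - 2 * k).choose (d - c) : ℝ)
      * (evenZeta (n - j - k) * Real.pi ^ (2 * j + 2 * k)) := by
  rw [trigCoeff_odd_even, halfCoeff_zero_odd hj, halfCoeff_one_even hk,
    show 2 * d - 2 * c - 2 * k = 2 * (d - c) - 2 * k by omega]
  obtain ⟨b, rfl⟩ := Nat.exists_eq_add_of_le hcd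
  obtain ⟨e, rfl⟩ := Nat.exists_eq_add_of_le' hc
  rw [Nat.add_sub_cancel_left, show e + 1 + b - 1 = e + b by omega, Nat.factorial_succ,
    pow_add 4 e b, pow_succ 4 e, pow_add 4 j k, add_assoc (e + 1) j k, pow_add (-1) (e + 1)]
  -- With b = d - c, the sign from expanding the sine at -y cancels the sign of `halfCoeff 1 b`.
  have hs := neg_one_pow_mul_self b
  generalize (-1 : ℝ) ^ b = s at hs
  generalize (-1 : ℝ) ^ (e + 1) = s'
  generalize (-1 : ℝ) ^ (j + k) = s''
  have : ((2 * j).factorial : ℝ) ≠ 0 := by positivity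
  have : ((2 * k).factorial : ℝ) ≠ 0 := by positivity
  push_cast
  field_simp
  rw [sq, hs]
  ring

theorem even_odd_term {n d c j k : ℕ} (hc : 1 ≤ c) (hcd : c ≤ d) (hj1 : 1 ≤ j) (hj : 2 * j ≤ c)
    (hk : 2 * k + 1 ≤ d - c) :
    (-1) ^ (d - c) * (halfCoeff 0 c (2 * j) * halfCoeff 1 (d - c) (2 * k + 1)
      / ((2 * j).factorial * (2 * k + 1).factorial) * trigCoeff (2 * j) (2 * k + 1) n)
    = (-1) ^ (c + j + k) * (4 * (4 ^ j * 4 ^ k) / (4 ^ n * 4 ^ d))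
        / ((c : ℝ) * ((2 * j - 1).factorial : ℝ) * ((2 * k + 1).factorial : ℝ))
      * ((2 * c - 2 * j - 1).choose (c - 1) : ℝ)
      * ((2 * d - 2 * c - 2 * k - 1).choose (d - c) : ℝ)
      * (evenZeta (n - j - k) * Real.pi ^ (2 * j + 2 * k)) := by
  rw [trigCoeff_even_odd, halfCoeff_zero_even hj1 hj, halfCoeff_one_odd hk,
    show 2 * d - 2 * c - 2 * k - 1 = 2 * (d - c) - 2 * k - 1 by omega]
  obtain ⟨b, rfl⟩ := Nat.exists_eq_add_of_le hcd
  rw [Nat.add_sub_cancel_left, pow_add 4 c b, add_assoc c j k, pow_add (-1) c,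
    ← Nat.mul_factorial_pred (show 2 * j ≠ 0 by omega)]
  have hs := neg_one_pow_mul_self b
  generalize (-1 : ℝ) ^ b = s at hs
  generalize (-1 : ℝ) ^ c = s'
  generalize (-1 : ℝ) ^ (j + k) = s''
  have : ((2 * j - 1).factorial : ℝ) ≠ 0 := by positivity
  have : ((2 * k + 1).factorial : ℝ) ≠ 0 := by positivity
  have : (c : ℝ) ≠ 0 := by positivity
  have : (j : ℝ) ≠ 0 := by positivity
  push_cast
  field_simp
  rw [sq, hs]
  ring

/-- Only opposite parities of l and l' survive: odd l gives the tangent sum, even l the cotangent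
sum, which starts at j = 1 because the l = 0 coefficient vanishes for c ≥ 1. -/
theorem sum_depth_pos_term {n d c : ℕ} (hc : 1 ≤ c) (hcd : c ≤ d) :
    (-1) ^ (d - c) * ∑ l ∈ range (c + 1), ∑ l' ∈ range (d - c + 1),
      halfCoeff 0 c l * halfCoeff 1 (d - c) l' / (l.factorial * l'.factorial) * trigCoeff l l' n
    = (∑ j ∈ range ((c + 1) / 2), ∑ k ∈ range ((d - c) / 2 + 1),
        (-1) ^ (c + j + k) * (1 - 4 ^ j * 4 ^ k / 4 ^ n)
          / ((c : ℝ) * ((2 * j).factorial : ℝ) * ((2 * k).factorial : ℝ) * 4 ^ (d - 1))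
        * ((2 * c - 2 * j - 2).choose (c - 1) : ℝ) * ((2 * d - 2 * c - 2 * k).choose (d - c) : ℝ)
        * (evenZeta (n - j - k) * Real.pi ^ (2 * j + 2 * k)))
      + ∑ j ∈ Icc 1 (c / 2), ∑ k ∈ range ((d - c + 1) / 2),
        (-1) ^ (c + j + k) * (4 * (4 ^ j * 4 ^ k) / (4 ^ n * 4 ^ d))
          / ((c : ℝ) * ((2 * j - 1).factorial : ℝ) * ((2 * k + 1).factorial : ℝ))
        * ((2 * c - 2 * j - 1).choose (c - 1) : ℝ)
        * ((2 * d - 2 * c - 2 * k - 1).choose (d - c) : ℝ)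
        * (evenZeta (n - j - k) * Real.pi ^ (2 * j + 2 * k)) := by
  have h0 : halfCoeff 0 c (2 * 0) = 0 := by
    obtain ⟨e, rfl⟩ := Nat.exists_eq_add_of_le' hc
    exact halfCoeff_zero_zero e
  rw [sum_range_succ_parity, mul_add, add_comm]
  congr 1
  · rw [mul_sum]
    refine sum_congr rfl fun j hj => ?_
    rw [sum_range_succ_parity, mul_add, mul_sum, mul_sum, sum_eq_zero (s := range ((d - c + 1) / 2))
      fun k _ => by rw [trigCoeff_odd_odd, mul_zero, mul_zero], add_zero]
    refine sum_congr rfl fun k hk => ?_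
    have := mem_range.1 hj
    have := mem_range.1 hk
    exact odd_even_term hc hcd (by omega) (by omega)
  · rw [sum_range_succ', sum_Icc_one]
    simp only [h0, zero_mul, zero_div, sum_const_zero, add_zero]
    rw [mul_sum]
    refine sum_congr rfl fun j hj => ?_
    rw [sum_range_succ_parity, mul_add, mul_sum, mul_sum,
      sum_eq_zero (s := range ((d - c) / 2 + 1)) fun k _ => by
        rw [trigCoeff_even_even, mul_zero, mul_zero], zero_add]
    refine sum_congr rfl fun k hk => ?_
    have := mem_range.1 hj
    have := mem_range.1 hk
    exact even_odd_term hc hcd (by omega) (by omega) (by omega)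

theorem A_eq_real {n d : ℕ} (hd : 1 ≤ d) (hdn : d ≤ n) :
    A d n d = (∑ j ∈ range ((d + 1) / 2), (-1) ^ j * (4 * 4 ^ j / (4 ^ n * 4 ^ d))
        / ((2 * j + 1).factorial : ℝ) * ((2 * d - 2 * j - 1).choose d : ℝ)
        * evenZeta (n - j) * Real.pi ^ (2 * j))
      + (∑ c ∈ Icc 1 d, ∑ j ∈ range ((c + 1) / 2), ∑ k ∈ range ((d - c) / 2 + 1),
        (-1) ^ (c + j + k) * (1 - 4 ^ j * 4 ^ k / 4 ^ n)
          / ((c : ℝ) * ((2 * j).factorial : ℝ) * ((2 * k).factorial : ℝ) * 4 ^ (d - 1))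
        * ((2 * c - 2 * j - 2).choose (c - 1) : ℝ) * ((2 * d - 2 * c - 2 * k).choose (d - c) : ℝ)
        * (evenZeta (n - j - k) * Real.pi ^ (2 * j + 2 * k)))
      + ∑ c ∈ Icc 1 d, ∑ j ∈ Icc 1 (c / 2), ∑ k ∈ range ((d - c + 1) / 2),
        (-1) ^ (c + j + k) * (4 * (4 ^ j * 4 ^ k) / (4 ^ n * 4 ^ d))
          / ((c : ℝ) * ((2 * j - 1).factorial : ℝ) * ((2 * k + 1).factorial : ℝ))
        * ((2 * c - 2 * j - 1).choose (c - 1) : ℝ)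
        * ((2 * d - 2 * c - 2 * k - 1).choose (d - c) : ℝ)
        * (evenZeta (n - j - k) * Real.pi ^ (2 * j + 2 * k)) := by
  rw [A_eq_sum_trigCoeff hd hdn, Finset.Nat.sum_antidiagonal_eq_sum_range_succ_mk, sum_range_succ',
    add_comm, add_assoc, ← sum_add_distrib]
  congr 1
  · exact sum_depth_zero_term n d
  · rw [sum_Icc_one]
    refine sum_congr rfl fun c hc => ?_
    have := mem_range.1 hc
    exact sum_depth_pos_term (by omega) (by omega)

/-! ### Passage to complex numbers, integer powers of 4 and the Riemann zeta function -/

theorem four_zpow_eq (i n d : ℕ) :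
    (4 : ℂ) ^ ((i : ℤ) - n - d + 1) = 4 * 4 ^ i / (4 ^ n * 4 ^ d) := by
  have h4 : (4 : ℂ) ≠ 0 := by norm_num
  rw [zpow_add_one₀ h4, zpow_sub₀ h4, zpow_sub₀ h4]
  simp only [zpow_natCast]
  field_simp

theorem four_zpow_sub_eq (i n : ℕ) : (4 : ℂ) ^ ((i : ℤ) - n) = 4 ^ i / 4 ^ n := by
  rw [zpow_sub₀ (by norm_num)]
  simp only [zpow_natCast]

theorem riemannZeta_sub {n i : ℕ} (h : i < n) :
    riemannZeta (2 * (n : ℂ) - 2 * (i : ℂ)) = ((evenZeta (n - i) : ℝ) : ℂ) := by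
  rw [← riemannZeta_two_mul (by omega), Nat.cast_sub h.le, mul_sub]

theorem z_eq {n j k : ℕ} (h : j + k < n) :
    z n j k = ((evenZeta (n - j - k) * Real.pi ^ (2 * j + 2 * k) : ℝ) : ℂ) := by
  rw [z, Nat.sub_sub, Complex.ofReal_mul, ← riemannZeta_sub h]
  push_cast
  congr 2
  ring

end EulerSums

/-- The upper limits `⌊(m - 1) / 2⌋` (which is `-1`, an empty sum, for `m = 0`) are written as
`Finset.range ((m + 1) / 2)`. -/
theorem mainTheorem5 (n d : ℕ) (hd : 1 ≤ d) (hdn : d ≤ n) :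
    (∀ j ∈ EulerSums.compositions n d, ∀ ε ∈ EulerSums.signs d d,
      Summable (EulerSums.term (fun i => 2 * j i) ε)) ∧
    ((EulerSums.A d n d : ℝ) : ℂ) =
      (∑ j ∈ Finset.range ((d + 1) / 2),
        (-1 : ℂ) ^ j * (4 : ℂ) ^ ((j : ℤ) - n - d + 1) / (Nat.factorial (2 * j + 1) : ℂ)
          * (Nat.choose (2 * d - 2 * j - 1) d : ℂ)
          * riemannZeta (2 * (n : ℂ) - 2 * (j : ℂ)) * (Real.pi : ℂ) ^ (2 * j))
      + (∑ c ∈ Finset.Icc 1 d, ∑ j ∈ Finset.range ((c + 1) / 2),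
          ∑ k ∈ Finset.range ((d - c) / 2 + 1),
          (-1 : ℂ) ^ (c + j + k) * (1 - (4 : ℂ) ^ ((j : ℤ) + k - n))
              / ((c : ℂ) * (Nat.factorial (2 * j) : ℂ) * (Nat.factorial (2 * k) : ℂ)
                  * (4 : ℂ) ^ (d - 1))
            * (Nat.choose (2 * c - 2 * j - 2) (c - 1) : ℂ)
            * (Nat.choose (2 * d - 2 * c - 2 * k) (d - c) : ℂ)
            * EulerSums.z n j k)
      + (∑ c ∈ Finset.Icc 1 d, ∑ j ∈ Finset.Icc 1 (c / 2),
          ∑ k ∈ Finset.range ((d - c + 1) / 2),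
          (-1 : ℂ) ^ (c + j + k) * (4 : ℂ) ^ ((j : ℤ) + k - n - d + 1)
              / ((c : ℂ) * (Nat.factorial (2 * j - 1) : ℂ) * (Nat.factorial (2 * k + 1) : ℂ))
            * (Nat.choose (2 * c - 2 * j - 1) (c - 1) : ℂ)
            * (Nat.choose (2 * d - 2 * c - 2 * k - 1) (d - c) : ℂ)
            * EulerSums.z n j k) := by
  refine ⟨fun j hj ε _ => EulerSums.summable_term _ (fun i => ?_) ε, ?_⟩
  · have : 0 < j i := (Finset.mem_filter.1 hj).2 i
    omega
  · rw [EulerSums.A_eq_real hd hdn, Complex.ofReal_add, Complex.ofReal_add, Complex.ofReal_sum,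
      Complex.ofReal_sum, Complex.ofReal_sum]
    congr 1
    · congr 1
      · refine Finset.sum_congr rfl fun j hj => ?_
        have := Finset.mem_range.1 hj
        rw [EulerSums.riemannZeta_sub (by omega), EulerSums.four_zpow_eq]
        push_cast
        rfl
      · refine Finset.sum_congr rfl fun c hc => ?_
        have hc' := Finset.mem_Icc.1 hc
        rw [Complex.ofReal_sum]
        refine Finset.sum_congr rfl fun j hj => ?_
        have := Finset.mem_range.1 hj
        rw [Complex.ofReal_sum]
        refine Finset.sum_congr rfl fun k hk => ?_
        have := Finset.mem_range.1 hk
        -- 2j + 1 ≤ c and 2k ≤ d - c give j + k < n, so the zeta argument is at least 2.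
        rw [EulerSums.z_eq (by omega), ← Nat.cast_add, EulerSums.four_zpow_sub_eq, pow_add 4 j k]
        push_cast
        rfl
    · refine Finset.sum_congr rfl fun c hc => ?_
      have hc' := Finset.mem_Icc.1 hc
      rw [Complex.ofReal_sum]
      refine Finset.sum_congr rfl fun j hj => ?_
      have := Finset.mem_Icc.1 hj
      rw [Complex.ofReal_sum]
      refine Finset.sum_congr rfl fun k hk => ?_
      have := Finset.mem_range.1 hk
      rw [EulerSums.z_eq (by omega), ← Nat.cast_add, EulerSums.four_zpow_eq, pow_add 4 j k]
      push_cast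
      rfl
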